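/- Let $M$ be a smooth $n$-dimensional manifold with a filtration $H_1\subset\cdots\subset H_r=TM$ by smooth subbundles of constant rank such that $[H_w,H_{w'}]\subset H_{w+w'}$ whenever $w+w'\le r$ (a Carnot manifold of step $r\geq 1$). Set $w_j=\min\{w\in\{1,\dots,r\}:\ j\le \operatorname{rk}H_w\}$ for $j=1,\dots,n$. Let $a\in M$ and let $(X_1,\dots,X_n)$ be an $H$-frame near $a$, i.e. a smooth tangent frame over an open neighbourhood of $a$ such that $X_j$ is a section of $H_{w_j}$. *Definitions.* A smooth function $f$ near $a$ has order $N$ at $a$ if $X_{i_1}\cdots X_{i_k}f(a)=0$ whenever $w_{i_1}+\cdots+w_{i_k}<N$, and $X_{i_1}\cdots X_{i_k}f(a)\ne0$ for some $(i_1,\dots,i_k)$ with $w_{i_1}+\cdots+w_{i_k}=N$. Local coordinates $(x_1,\dots,x_n)$ centered at $a$ are linearly adapted if $X_j=\partial_{x_j}$ at $a$ for every $j$; they are privileged at $a$, adapted to $(X_1,\dots,X_n)$, if they are linearly adapted and $x_k$ has order $w_k$ at $a$ for every $k$. For $\alpha\in\mathbb N_0^n$ put $|\alpha|=\sum_i\alpha_i$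 and $\langle\alpha\rangle=\sum_i w_i\alpha_i$; put $t\cdot x=(t^{w_1}x_1,\dots,t^{w_n}x_n)$. A map $f:\mathbb R^n\to\mathbb R^n$ is $w$-homogeneous if $f(t\cdot x)=t\cdot f(x)$ for all $t\in\mathbb R$, $x\in\mathbb R^n$. Let $\|\cdot\|$ be a pseudo-norm, i.e. a continuous function $\mathbb R^n\to[0,\infty)$, positive off $0$, with $\|t\cdot x\|=|t|\,\|x\|$. We write $\Theta=\mathrm O_w(\|x\|^{w+1})$ if $\Theta_k(x)=\mathrm O(\|x\|^{w_k+1})$ near $x=0$ for every $k$. For a local chart $\kappa$ near $a$ with $\kappa(a)=0$, let $\psi_{\kappa(a)}:\mathbb R^n\to\mathbb R^n$ be the map $\hat\psi\circ T$, where $T$ is an affine isomorphism such that $T\circ\kappa$ gives coordinates centered at $a$ and linearly adapted, and $\hat\psi$ is a polynomial map with $\hat\psi_k(x)=x_k+\sum_{\langle\alpha\rangle<w_k,\ |\alpha|\ge2}a_{k\alpha}x^\alpha$ such that $\hat\psi\circ T\circ\kappa$ gives privileged coordinates at $a$ adapted to $(X_1,\dots,X_n)$. Call a diffeomorphism $\phi$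 from an open neighbourhood of $0\in\mathbb R^n$ onto an open subset of $\mathbb R^n$ *admissible* if $\phi'(0)=\mathrm{id}$ and, near $x=0$, $$\phi(x)=\hat\phi(x)+\mathrm O_w(\|x\|^{w+1}),$$ where $\hat\phi:\mathbb R^n\to\mathbb R^n$ is a $w$-homogeneous polynomial diffeomorphism with $\hat\phi'(0)=\mathrm{id}$. **Corollary.** For every chart $\kappa$ near $a$ with $\kappa(a)=0$, the map $\psi_{\kappa(a)}$ exists and is unique. Let $\chi$ be a local chart near $a$. The coordinates given by $\chi$ are privileged at $a$ adapted to $(X_1,\dots,X_n)$ if and only if $\chi$ is of the form $\phi\circ\psi_{\kappa(a)}\circ\kappa$ (on its natural domain), where $\kappa$ is some local chart near $a$ with $\kappa(a)=0$ and $\phi$ is admissible. Moreover, for every chart $\kappa$ near $a$ with $\kappa(a)=0$ given in advance, they are privileged if and only if $\chi=\phi\circ\psi_{\kappa(a)}\circ\kappa$ near $a$ for some admissible $\phi$. -/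

import Mathlib

open scoped Manifold ContDiff Topology

namespace CarnotMfd

noncomputable section

/-- `n`-dimensional Euclidean space, the model of all the manifolds below. -/
abbrev Euc (n : ℕ) : Type := EuclideanSpace ℝ (Fin n)

/-- A (not necessarily continuous) vector field on `M`, given on all of `M`; smoothness is always
required only on an open set. -/
abbrev VField (n : ℕ) (M : Type*) [TopologicalSpace M] [ChartedSpace (Euc n) M] : Type _ :=
  (x : M) → TangentSpace (𝓡 n) x

/-- `X` is a smooth vector field on the set `U`. -/
def SmoothVFieldOn {n : ℕ} {M : Type*} [TopologicalSpace M] [ChartedSpace (Euc n) M]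
    [IsManifold (𝓡 n) ∞ M] (X : VField n M) (U : Set M) : Prop :=
  ContMDiffOn (𝓡 n) (𝓡 n).tangent ∞
    (fun x => (⟨x, X x⟩ : TangentBundle (𝓡 n) M)) U

/-- A step `r` Carnot filtration `H 1 ⊆ ⋯ ⊆ H r = TM` on an `n`-dimensional manifold: the `H w`,
`1 ≤ w ≤ r`, are smooth subbundles of constant rank `rk w` such that `[H w, H w'] ⊆ H (w + w')`
for `w + w' ≤ r`. (Values of `H` and `rk` at other indices are never used.) -/
structure CarnotFiltration (n r : ℕ) (M : Type*) [TopologicalSpace M] [ChartedSpace (Euc n) M]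
    [IsManifold (𝓡 n) ∞ M] where
  /-- The fibers of the subbundles. -/
  H : ℕ → (x : M) → Submodule ℝ (TangentSpace (𝓡 n) x)
  /-- The ranks of the subbundles. -/
  rk : ℕ → ℕ
  one_le_step : 1 ≤ r
  /-- Near every point `H w` is spanned by `rk w` independent smooth vector fields. -/
  subbundle : ∀ w, 1 ≤ w → w ≤ r → ∀ p : M, ∃ U : Set M, IsOpen U ∧ p ∈ U ∧
    ∃ Y : Fin (rk w) → VField n M, (∀ i, SmoothVFieldOn (Y i) U) ∧
      ∀ q ∈ U, LinearIndependent ℝ (fun i => Y i q) ∧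
        Submodule.span ℝ (Set.range fun i => Y i q) = H w q
  mono : ∀ w w', 1 ≤ w → w ≤ w' → w' ≤ r → ∀ x, H w x ≤ H w' x
  top : ∀ x, H r x = ⊤
  bracket : ∀ w w', 1 ≤ w → 1 ≤ w' → w + w' ≤ r →
    ∀ U : Set M, IsOpen U → ∀ Y Z : VField n M, SmoothVFieldOn Y U → SmoothVFieldOn Z U →
      (∀ x ∈ U, Y x ∈ H w x) → (∀ x ∈ U, Z x ∈ H w' x) →
      ∀ x ∈ U, VectorField.mlieBracket (𝓡 n) Y Z x ∈ H (w + w') x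

section Order

variable {n : ℕ} {M : Type*} [TopologicalSpace M] [ChartedSpace (Euc n) M]

/-- The derivative `X f` of the function `f` along the vector field `X`. -/
def lieDeriv (X : VField n M) (f : M → ℝ) : M → ℝ :=
  fun x => mfderiv (𝓡 n) 𝓘(ℝ, ℝ) f x (X x)

/-- `X_I f = X_{i₁} (X_{i₂} (⋯ (X_{iₖ} f)))` for `I = (i₁, …, iₖ)`. -/
def iterDeriv (X : Fin n → VField n M) (I : List (Fin n)) (f : M → ℝ) : M → ℝ :=
  I.foldr (fun i g => lieDeriv (X i) g) f

/-- `⟨I⟩ = w_{i₁} + ⋯ + w_{iₖ}`. -/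
def listWeight (w : Fin n → ℕ) (I : List (Fin n)) : ℕ := (I.map w).sum

/-- `f` has order `N` at `a` with respect to the vector fields `X` of weights `w`. -/
def HasOrder (X : Fin n → VField n M) (w : Fin n → ℕ) (a : M) (f : M → ℝ) (N : ℕ) : Prop :=
  (∀ I : List (Fin n), listWeight w I < N → iterDeriv X I f a = 0) ∧
    ∃ I : List (Fin n), listWeight w I = N ∧ iterDeriv X I f a ≠ 0

/-- The coordinates `θ = (θ₁, …, θₙ)` are centered at `a` and satisfy `X_j(0) = ∂_j`: the
differential of `θ` at `a` maps `X_j(a)` to the `j`-th standard basis vector. -/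
def LinearlyAdapted (X : Fin n → VField n M) (a : M) (θ : M → Euc n) : Prop :=
  θ a = 0 ∧ ∀ j, mfderiv (𝓡 n) 𝓘(ℝ, Euc n) θ a (X j a) = EuclideanSpace.single j (1 : ℝ)

/-- The coordinates `θ` are privileged at `a`, adapted to the frame `X` of weights `w`. -/
def Privileged (X : Fin n → VField n M) (w : Fin n → ℕ) (a : M) (θ : M → Euc n) : Prop :=
  LinearlyAdapted X a θ ∧ ∀ k, HasOrder X w a (fun p => θ p k) (w k)

/-- `κ` is a smooth local chart near `a` such that `κ a = 0`. -/
structure IsCenteredChart (a : M) (κ : OpenPartialHomeomorph M (Euc n)) : Prop where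
  mem_maximalAtlas : κ ∈ IsManifold.maximalAtlas (𝓡 n) ∞ M
  mem_source : a ∈ κ.source
  map_zero : κ a = 0

end Order

section Frames

variable {n r : ℕ} {M : Type*} [TopologicalSpace M] [ChartedSpace (Euc n) M]
  [IsManifold (𝓡 n) ∞ M]

/-- The weight sequence `w_j = min {w ∈ {1, …, r} | j ≤ rk H_w}`, `1 ≤ j ≤ n`; the index `j : Fin n`
stands for `j + 1`. -/
def CarnotFiltration.weight (H : CarnotFiltration n r M) (j : Fin n) : ℕ :=
  sInf {w : ℕ | 1 ≤ w ∧ w ≤ r ∧ (j : ℕ) + 1 ≤ H.rk w}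

/-- `X` is an `H`-frame over `U`: a smooth tangent frame over `U` such that `X_j` is a section of
`H_w` for `w = w_j`. -/
structure IsHFrameOn (H : CarnotFiltration n r M) (X : Fin n → VField n M) (U : Set M) :
    Prop where
  smooth : ∀ j, SmoothVFieldOn (X j) U
  linearIndependent : ∀ x ∈ U, LinearIndependent ℝ (fun j => X j x)
  span_eq_top : ∀ x ∈ U, Submodule.span ℝ (Set.range fun j => X j x) = ⊤
  mem : ∀ j, ∀ x ∈ U, X j x ∈ H.H (H.weight j) x

end Frames

section Anisotropic

variable {n : ℕ}

/-- `⟨α⟩ = w₁ α₁ + ⋯ + wₙ αₙ` for a multi-order `α`. -/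
def multiWeight (w : Fin n → ℕ) (α : Fin n →₀ ℕ) : ℕ := ∑ i, w i * α i

/-- `|α| = α₁ + ⋯ + αₙ` for a multi-order `α`. -/
def multiLength (α : Fin n →₀ ℕ) : ℕ := ∑ i, α i

/-- The anisotropic dilation `t · x = (t^{w₁} x₁, …, t^{wₙ} xₙ)`. -/
def dilation (w : Fin n → ℕ) (t : ℝ) (x : Euc n) : Euc n :=
  WithLp.toLp 2 fun k => t ^ w k * x k

/-- A pseudo-norm for the dilations with weights `w`. -/
structure IsPseudoNorm (w : Fin n → ℕ) (N : Euc n → ℝ) : Prop where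
  continuous : Continuous N
  nonneg : ∀ x, 0 ≤ N x
  pos : ∀ x, x ≠ 0 → 0 < N x
  dilation : ∀ t x, N (dilation w t x) = |t| * N x

/-- `Θ = O_w(‖x‖^{w+1})` near `0`, i.e. `Θ_k(x) = O(‖x‖^{w_k + 1})` for every `k`, where `N` is the
pseudo-norm `‖·‖`. -/
def IsBigOw (w : Fin n → ℕ) (N : Euc n → ℝ) (Θ : Euc n → Euc n) : Prop :=
  ∀ k, (fun x => Θ x k) =O[𝓝 0] fun x => N x ^ (w k + 1)

/-- All the components of the map `f` are polynomials. -/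
def IsPolynomialMap (f : Euc n → Euc n) : Prop :=
  ∃ P : Fin n → MvPolynomial (Fin n) ℝ, ∀ x k, f x k = MvPolynomial.eval (fun i => x i) (P k)

/-- `f (t · x) = t · f x` for all `t` and `x`. -/
def IsWHomogeneous (w : Fin n → ℕ) (f : Euc n → Euc n) : Prop :=
  ∀ t x, f (dilation w t x) = dilation w t (f x)

/-- `f_k(x) = x_k + ∑ a_{kα} x^α` for every `k`, where the (finite) sum is over multi-orders `α`
with `⟨α⟩ < w_k` and `|α| ≥ 2`. -/
def IsTriangularPoly (w : Fin n → ℕ) (f : Euc n → Euc n) : Prop :=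
  ∃ P : Fin n → MvPolynomial (Fin n) ℝ,
    (∀ k, ∀ α ∈ (P k).support, multiWeight w α < w k ∧ 2 ≤ multiLength α) ∧
      ∀ x k, f x k = x k + MvPolynomial.eval (fun i => x i) (P k)

/-- `φ` is a diffeomorphism near the origin such that `φ'(0) = id` and
`φ(x) = φ̂(x) + O_w(‖x‖^{w+1})` near `0`, where `φ̂` is a `w`-homogeneous polynomial diffeomorphism
of `ℝⁿ` such that `φ̂'(0) = id`. -/
structure IsAdmissibleChange (w : Fin n → ℕ) (N : Euc n → ℝ)
    (φ : OpenPartialHomeomorph (Euc n) (Euc n)) : Prop where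
  zero_mem : (0 : Euc n) ∈ φ.source
  contDiffOn : ContDiffOn ℝ ∞ φ φ.source
  contDiffOn_symm : ContDiffOn ℝ ∞ φ.symm φ.target
  hasFDerivAt : HasFDerivAt φ (ContinuousLinearMap.id ℝ (Euc n)) 0
  expansion : ∃ φ' : Diffeomorph 𝓘(ℝ, Euc n) 𝓘(ℝ, Euc n) (Euc n) (Euc n) ∞,
    IsPolynomialMap φ' ∧ IsWHomogeneous w φ' ∧
      HasFDerivAt φ' (ContinuousLinearMap.id ℝ (Euc n)) 0 ∧
      IsBigOw w N fun x => φ x - φ' x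

end Anisotropic

section Psi

variable {n : ℕ} {M : Type*} [TopologicalSpace M] [ChartedSpace (Euc n) M]

/-- `ψ = ψ̂ ∘ T`, where `T` is an affine change of coordinates such that the coordinates `T ∘ κ` are
centered at `a` and linearly adapted, and `ψ̂` is a polynomial map of the above triangular form such
that the coordinates `ψ̂ ∘ T ∘ κ` are privileged at `a`. -/
def IsPsiMap (X : Fin n → VField n M) (w : Fin n → ℕ) (a : M) (κ : M → Euc n)
    (ψ : Euc n → Euc n) : Prop :=
  ∃ (T : Euc n ≃ᵃ[ℝ] Euc n) (ψ' : Euc n → Euc n), LinearlyAdapted X a (fun p => T (κ p)) ∧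
    IsTriangularPoly w ψ' ∧ Privileged X w a (fun p => ψ' (T (κ p))) ∧ ψ = fun x => ψ' (T x)

/-- The map `ψ_{κ(a)}`: the (unique) map `ψ` satisfying `IsPsiMap`. -/
def psiMap (X : Fin n → VField n M) (w : Fin n → ℕ) (a : M) (κ : M → Euc n) : Euc n → Euc n :=
  Classical.epsilon (IsPsiMap X w a κ)

end Psi

end

end CarnotMfd

/-!
In coordinates where the frame `X` is the standard basis at `0`, the value `X_I (x^α) (0)` only
depends on `I` up to order when `|I| ≤ |α|`, and it is nonzero exactly when `I` is a rearrangement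
of `α`. So a polynomial with monomials of weight `< N` is determined by its derivatives of
weight `< N` at `0`. The brackets `[X_i, X_j]` only involve fields of weight `≤ w_i + w_j`, so the
derivatives of weight `< N` of any function are in turn determined by those in a fixed order of the
factors, and a dimension count gives exactly one polynomial with the same derivatives. Applied to
the coordinate `x_k` and `N = w_k`, this is the existence and uniqueness of `ψ`.

If the coordinates are privileged, a Taylor polynomial turns order at least `N` at `0` into the
estimate `O(‖x‖^N)`. A second privileged system is therefore `φ(x)` with `φ_k = O(‖x‖^{w_k})`. The
part `φ̂_k` of weight `w_k` of `φ_k` is `x_k` plus a polynomial in the coordinates of weight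
`< w_k`, because `φ'(0) = id`, and such a triangular map is a diffeomorphism.
-/

namespace CarnotMfd

open Asymptotics Filter

section Weights

variable {n : ℕ}

theorem listWeight_cons (w : Fin n → ℕ) (i : Fin n) (I : List (Fin n)) :
    listWeight w (i :: I) = w i + listWeight w I := by simp [listWeight]

theorem listWeight_append_singleton (w : Fin n → ℕ) (I : List (Fin n)) (i : Fin n) :
    listWeight w (I ++ [i]) = listWeight w I + w i := by simp [listWeight]

theorem listWeight_one (I : List (Fin n)) : listWeight (fun _ => 1) I = I.length := by
  simp [listWeight]

theorem listWeight_perm (w : Fin n → ℕ) {I J : List (Fin n)} (h : I.Perm J) :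
    listWeight w I = listWeight w J := (h.map w).sum_eq

theorem length_le_listWeight {w : Fin n → ℕ} (hw : ∀ i, 1 ≤ w i) (I : List (Fin n)) :
    I.length ≤ listWeight w I := by
  simpa [listWeight] using List.length_le_sum_of_one_le (I.map w) fun m hm => by
    obtain ⟨i, -, rfl⟩ := List.mem_map.1 hm
    exact hw i

/-- A list in which every index `i` occurs `α i` times. It fixes the order of the factors in the
noncommutative monomial of multi-order `α`. -/
noncomputable def multiList (α : Fin n →₀ ℕ) : List (Fin n) := (Finsupp.toMultiset α).toList

theorem coe_multiList (α : Fin n →₀ ℕ) : (multiList α : Multiset (Fin n)) = Finsupp.toMultiset α :=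
  Multiset.coe_toList _

theorem exists_perm_multiList (I : List (Fin n)) : ∃ α : Fin n →₀ ℕ, I.Perm (multiList α) := by
  refine ⟨Multiset.toFinsupp (I : Multiset (Fin n)), ?_⟩
  rw [← Multiset.coe_eq_coe, coe_multiList, Multiset.toFinsupp_toMultiset]

theorem multiWeight_eq_weight (w : Fin n → ℕ) (α : Fin n →₀ ℕ) :
    multiWeight w α = Finsupp.weight w α := by
  simp [multiWeight, Finsupp.weight_eq_sum, mul_comm]

theorem multiWeight_one (α : Fin n →₀ ℕ) : multiWeight (fun _ => 1) α = multiLength α := by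
  simp [multiWeight, multiLength]

theorem listWeight_multiList (w : Fin n → ℕ) (α : Fin n →₀ ℕ) :
    listWeight w (multiList α) = multiWeight w α := by
  have h : listWeight w (multiList α) = ((Finsupp.toMultiset α).map w).sum := by
    rw [← coe_multiList, Multiset.map_coe, Multiset.sum_coe, listWeight]
  rw [h, Finsupp.toMultiset_map, Finsupp.sum_toMultiset, Finsupp.sum_mapDomain_index (by simp)
    (by intros; ring), multiWeight, Finsupp.sum_fintype _ _ (by simp)]
  simp [mul_comm]

theorem length_multiList (α : Fin n →₀ ℕ) : (multiList α).length = multiLength α := by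
  rw [← listWeight_one, listWeight_multiList, multiWeight_one]

theorem multiWeight_add (w : Fin n → ℕ) (α β : Fin n →₀ ℕ) :
    multiWeight w (α + β) = multiWeight w α + multiWeight w β := by
  simp only [multiWeight_eq_weight, map_add]

theorem multiWeight_single (w : Fin n → ℕ) (i : Fin n) (m : ℕ) :
    multiWeight w (Finsupp.single i m) = m * w i := by
  rw [multiWeight_eq_weight, Finsupp.weight_single, smul_eq_mul]

theorem finite_multiWeight_lt {w : Fin n → ℕ} (hw : ∀ i, 1 ≤ w i) (N : ℕ) :
    {α : Fin n →₀ ℕ | multiWeight w α < N}.Finite := by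
  simpa only [multiWeight_eq_weight] using
    Finsupp.finite_of_nat_weight_lt w (fun i => Nat.one_le_iff_ne_zero.1 (hw i)) N

end Weights

/-! ### Orders of vanishing with respect to derivations -/

section Derivations

open MvPolynomial

variable {n : ℕ} {K A : Type*}

section CommRing

variable [CommRing K] [CommRing A] [Algebra K A]

/-- The composition `D_{i₁} ∘ ⋯ ∘ D_{iₖ}`, the algebraic counterpart of `iterDeriv`. -/
def iterDer (D : Fin n → Derivation K A A) (I : List (Fin n)) : A →ₗ[K] A :=
  I.foldr (fun i L => (D i : A →ₗ[K] A) ∘ₗ L) LinearMap.id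

theorem iterDer_nil (D : Fin n → Derivation K A A) (f : A) : iterDer D [] f = f := rfl

theorem iterDer_cons (D : Fin n → Derivation K A A) (i : Fin n) (I : List (Fin n)) (f : A) :
    iterDer D (i :: I) f = D i (iterDer D I f) := rfl

theorem iterDer_append_singleton (D : Fin n → Derivation K A A) (I : List (Fin n)) (i : Fin n)
    (f : A) : iterDer D (I ++ [i]) f = iterDer D I (D i f) := by
  induction I with
  | nil => rfl
  | cons j I ih => rw [List.cons_append, iterDer_cons, ih, iterDer_cons]

/-- The elements of order at least `N` at the point `ev`: all their derivatives of weight `< N`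
vanish there. -/
def orderGE (ev : A →ₐ[K] K) (D : Fin n → Derivation K A A) (w : Fin n → ℕ) (N : ℕ) :
    Submodule K A where
  carrier := {f | ∀ I, listWeight w I < N → ev (iterDer D I f) = 0}
  zero_mem' I _ := by simp only [map_zero]
  add_mem' hf hg I hI := by rw [map_add, map_add, hf I hI, hg I hI, add_zero]
  smul_mem' c f hf I hI := by rw [map_smul, map_smul, hf I hI, smul_zero]

variable {ev : A →ₐ[K] K} {D : Fin n → Derivation K A A} {w v : Fin n → ℕ} {x : Fin n → A}

theorem mem_orderGE_zero (f : A) : f ∈ orderGE ev D w 0 :=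
  fun _ hI => absurd hI (Nat.not_lt_zero _)

theorem orderGE_anti {N N' : ℕ} (h : N ≤ N') : orderGE ev D w N' ≤ orderGE ev D w N :=
  fun _ hf I hI => hf I (hI.trans_le h)

theorem mem_orderGE_one (hw : ∀ i, 1 ≤ w i) {f : A} (hf : ev f = 0) : f ∈ orderGE ev D w 1 := by
  intro I hI
  obtain rfl : I = [] :=
    List.length_eq_zero_iff.1 (Nat.lt_one_iff.1 ((length_le_listWeight hw I).trans_lt hI))
  exact hf

theorem derivation_mem_orderGE {N : ℕ} {f : A} (hf : f ∈ orderGE ev D w N) (i : Fin n) :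
    D i f ∈ orderGE ev D w (N - w i) := by
  intro I hI
  rw [← iterDer_append_singleton]
  refine hf _ ?_
  rw [listWeight_append_singleton]
  omega

theorem mul_mem_orderGE {N N' : ℕ} {f g : A} (hf : f ∈ orderGE ev D w N)
    (hg : g ∈ orderGE ev D w N') : f * g ∈ orderGE ev D w (N + N') := by
  intro I
  induction I using List.reverseRecOn generalizing f g N N' with
  | nil =>
    intro h
    rw [iterDer_nil, map_mul]
    rcases Nat.eq_zero_or_pos N with h0 | h0
    · rw [show ev g = 0 from hg [] (by omega), mul_zero]
    · rw [show ev f = 0 from hf [] h0, zero_mul]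
  | append_singleton I i ih =>
    intro h
    rw [listWeight_append_singleton] at h
    rw [iterDer_append_singleton, Derivation.leibniz, smul_eq_mul, smul_eq_mul, map_add, map_add,
      ih hf (derivation_mem_orderGE hg i) (by omega),
      ih hg (derivation_mem_orderGE hf i) (by omega), add_zero]

theorem pow_mem_orderGE {N : ℕ} {f : A} (hf : f ∈ orderGE ev D w N) (m : ℕ) :
    f ^ m ∈ orderGE ev D w (N * m) := by
  induction m with
  | zero => exact mem_orderGE_zero _
  | succ m ih => rw [pow_succ, Nat.mul_succ]; exact mul_mem_orderGE ih hf

theorem prod_mem_orderGE {ι : Type*} (s : Finset ι) (f : ι → A) (N : ι → ℕ)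
    (h : ∀ i ∈ s, f i ∈ orderGE ev D w (N i)) :
    ∏ i ∈ s, f i ∈ orderGE ev D w (∑ i ∈ s, N i) := by
  classical
  induction s using Finset.induction_on with
  | empty => exact mem_orderGE_zero _
  | insert a s ha ih =>
    rw [Finset.prod_insert ha, Finset.sum_insert ha]
    exact mul_mem_orderGE (h a (Finset.mem_insert_self a s))
      (ih fun i hi => h i (Finset.mem_insert_of_mem hi))

theorem aeval_monomial_mem_orderGE (hx : ∀ k, x k ∈ orderGE ev D w (v k)) (α : Fin n →₀ ℕ)
    (c : K) : aeval x (monomial α c) ∈ orderGE ev D w (multiWeight v α) := by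
  rw [aeval_monomial, ← Algebra.smul_def, Finsupp.prod_fintype _ _ (by simp)]
  exact Submodule.smul_mem _ _ (prod_mem_orderGE _ _ _ fun i _ => pow_mem_orderGE (hx i) _)

theorem aeval_mem_orderGE (hx : ∀ k, x k ∈ orderGE ev D w (v k)) {p : MvPolynomial (Fin n) K}
    {N : ℕ} (hp : ∀ α ∈ p.support, N ≤ multiWeight v α) : aeval x p ∈ orderGE ev D w N := by
  rw [p.as_sum, map_sum]
  exact Submodule.sum_mem _ fun α hα =>
    orderGE_anti (hp α hα) (aeval_monomial_mem_orderGE hx α _)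

theorem derivation_aeval (d : Derivation K A A) (x : Fin n → A) (p : MvPolynomial (Fin n) K) :
    d (aeval x p) = ∑ k, aeval x (pderiv k p) * d (x k) := by
  induction p using MvPolynomial.induction_on with
  | C a => simp
  | add p q hp hq => simp [hp, hq, add_mul, Finset.sum_add_distrib]
  | mul_X p i hp =>
    simp only [map_mul, aeval_X, Derivation.leibniz, hp, smul_eq_mul, pderiv_X, map_add, add_mul,
      Finset.sum_add_distrib, Finset.mul_sum]
    congr 1
    · simp [Pi.single_apply, apply_ite (aeval x), ite_mul, mul_ite]
    · exact Finset.sum_congr rfl fun k _ => by ring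

/-- The elements `x` are linearly adapted coordinates at the point `ev`: they vanish there and the
derivations `D` act on them as the partial derivatives. -/
structure IsAdaptedCoord (ev : A →ₐ[K] K) (D : Fin n → Derivation K A A) (x : Fin n → A) :
    Prop where
  eval : ∀ k, ev (x k) = 0
  deriv : ∀ j k, ev (D j (x k)) = if j = k then 1 else 0

theorem IsAdaptedCoord.mem_orderGE_one (hx : IsAdaptedCoord ev D x) (k : Fin n) :
    x k ∈ orderGE ev D (fun _ => 1) 1 :=
  CarnotMfd.mem_orderGE_one (fun _ => le_rfl) (hx.eval k)

theorem le_multiLength_of_mem_support_pderiv {p : MvPolynomial (Fin n) K} {m : ℕ} {i : Fin n}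
    (hp : ∀ β ∈ p.support, m + 1 ≤ multiLength β) :
    ∀ β ∈ (pderiv i p).support, m ≤ multiLength β := by
  intro β hβ
  rw [mem_support_iff, coeff_pderiv] at hβ
  have h := hp _ (mem_support_iff.2 (left_ne_zero_of_mul hβ))
  rw [← multiWeight_one, multiWeight_add, multiWeight_single, multiWeight_one] at h
  omega

theorem derivation_aeval_sub_aeval_pderiv_mem_orderGE (hx : IsAdaptedCoord ev D x)
    {p : MvPolynomial (Fin n) K} {m : ℕ} (hp : ∀ β ∈ p.support, m + 1 ≤ multiLength β)
    (i : Fin n) : D i (aeval x p) - aeval x (pderiv i p) ∈ orderGE ev D (fun _ => 1) (m + 1) := by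
  have expand : D i (aeval x p) - aeval x (pderiv i p) =
      ∑ k, aeval x (pderiv k p) * (D i (x k) - if i = k then 1 else 0) := by
    simp [derivation_aeval, mul_sub, Finset.sum_sub_distrib]
  rw [expand]
  refine Submodule.sum_mem _ fun k _ => mul_mem_orderGE ?_ (mem_orderGE_one (fun _ => le_rfl) ?_)
  · refine aeval_mem_orderGE hx.mem_orderGE_one fun α hα => ?_
    rw [multiWeight_one]
    exact le_multiLength_of_mem_support_pderiv hp α hα
  · rw [map_sub, hx.deriv]
    split_ifs <;> simp

theorem eval_aeval (hx : ∀ k, ev (x k) = 0) (p : MvPolynomial (Fin n) K) :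
    ev (aeval x p) = coeff 0 p := by
  have h : ev.comp (aeval x) = aeval (fun _ : Fin n => (0 : K)) := by
    ext k
    simp [hx]
  rw [← AlgHom.comp_apply, h]
  simp [constantCoeff_eq]

-- To leading order the derivations `D i` act on polynomials in `x` as the commuting `∂/∂x i`.
theorem eval_iterDer_aeval (hx : IsAdaptedCoord ev D x) (I : List (Fin n))
    {p : MvPolynomial (Fin n) K} (hp : ∀ β ∈ p.support, I.length ≤ multiLength β) :
    ev (iterDer D I (aeval x p)) = coeff 0 (iterDer pderiv I p) := by
  induction I using List.reverseRecOn generalizing p with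
  | nil => exact eval_aeval hx.eval p
  | append_singleton I i ih =>
    rw [List.length_append, List.length_singleton] at hp
    have leading := derivation_aeval_sub_aeval_pderiv_mem_orderGE hx hp i I
      (by rw [listWeight_one]; omega)
    rw [map_sub, map_sub, sub_eq_zero] at leading
    rw [iterDer_append_singleton, iterDer_append_singleton, leading,
      ih (le_multiLength_of_mem_support_pderiv hp)]

theorem coeff_single_eq_eval_derivation (hx : IsAdaptedCoord ev D x)
    (p : MvPolynomial (Fin n) K) (j : Fin n) :
    p.coeff (Finsupp.single j 1) = ev (D j (aeval x p)) := by
  simp [derivation_aeval, hx.deriv, eval_aeval hx.eval, coeff_pderiv]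

/-- The structure equations of a frame of weights `w`: the bracket `[D_i, D_j]` only involves the
`D_k` with `w_k ≤ w_i + w_j`. -/
def BracketCompatible (D : Fin n → Derivation K A A) (w : Fin n → ℕ) : Prop :=
  ∀ i j, ⁅D i, D j⁆ ∈ Submodule.span A (D '' {k | w k ≤ w i + w j})

theorem apply_mem_ideal_of_mem_span {s : Set (Fin n)} {E : Derivation K A A}
    (hE : E ∈ Submodule.span A (D '' s)) {g : A} {J : Ideal A} (h : ∀ k ∈ s, D k g ∈ J) :
    E g ∈ J := by
  induction hE using Submodule.span_induction with
  | mem E hE =>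
    obtain ⟨k, hk, rfl⟩ := hE
    exact h k hk
  | zero => exact J.zero_mem
  | add E F _ _ hE hF => exact J.add_mem hE hF
  | smul c E _ hE => exact J.mul_mem_left c hE

/-- The ideal generated by all derivatives of `f` of length `< l` and weight `≤ W`. Modulo it, the
derivatives of length `l` and weight `W` do not depend on the order of the factors. -/
def derivIdeal (D : Fin n → Derivation K A A) (w : Fin n → ℕ) (f : A) (l W : ℕ) : Ideal A :=
  Ideal.span {g | ∃ J, J.length < l ∧ listWeight w J ≤ W ∧ g = iterDer D J f}

theorem derivation_mem_derivIdeal {f g : A} {l W : ℕ} (hg : g ∈ derivIdeal D w f l W)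
    (i : Fin n) : D i g ∈ derivIdeal D w f (l + 1) (w i + W) := by
  have mono : derivIdeal D w f l W ≤ derivIdeal D w f (l + 1) (w i + W) := by
    refine Ideal.span_mono ?_
    rintro _ ⟨J, hJl, hJw, rfl⟩
    exact ⟨J, by omega, by omega, rfl⟩
  induction hg using Submodule.span_induction with
  | mem g hg =>
    obtain ⟨J, hJl, hJw, rfl⟩ := hg
    refine Ideal.subset_span ⟨i :: J, ?_, ?_, rfl⟩
    · rw [List.length_cons]; omega
    · rw [listWeight_cons]; omega
  | zero => rw [map_zero]; exact Submodule.zero_mem _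
  | add a b _ _ ha hb => rw [map_add]; exact Submodule.add_mem _ ha hb
  | smul c a ha ih =>
    rw [smul_eq_mul, Derivation.leibniz]
    exact Submodule.add_mem _ (Submodule.smul_mem _ _ ih) (Ideal.mul_mem_right _ _ (mono ha))

theorem iterDer_sub_mem_derivIdeal (hD : BracketCompatible D w) (f : A) {I J : List (Fin n)}
    (h : I.Perm J) :
    iterDer D I f - iterDer D J f ∈ derivIdeal D w f I.length (listWeight w I) := by
  induction h with
  | nil => rw [sub_self]; exact Submodule.zero_mem _
  | cons i h ih =>
    rw [iterDer_cons, iterDer_cons, ← map_sub, List.length_cons, listWeight_cons]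
    exact derivation_mem_derivIdeal ih i
  | swap i j I =>
    rw [iterDer_cons, iterDer_cons, iterDer_cons, iterDer_cons, ← Derivation.commutator_apply]
    refine apply_mem_ideal_of_mem_span (hD j i) fun k hk =>
      Ideal.subset_span ⟨k :: I, ?_, ?_, rfl⟩
    · simp
    · rw [Set.mem_ofPred_eq] at hk
      simp only [listWeight_cons]
      omega
  | trans h₁ _ ih₁ ih₂ =>
    rw [← h₁.length_eq, ← listWeight_perm w h₁] at ih₂
    rw [← sub_add_sub_cancel]
    exact Submodule.add_mem _ ih₁ ih₂

theorem mem_orderGE_of_multiList (hD : BracketCompatible D w) {f : A} {N : ℕ}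
    (h : ∀ α, multiWeight w α < N → ev (iterDer D (multiList α) f) = 0) :
    f ∈ orderGE ev D w N := by
  intro I
  induction hl : I.length using Nat.strong_induction_on generalizing I with
  | _ l ih =>
    intro hI
    obtain ⟨α, hα⟩ := exists_perm_multiList I
    have ideal_le : derivIdeal D w f I.length (listWeight w I) ≤ RingHom.ker ev := by
      refine Ideal.span_le.2 ?_
      rintro _ ⟨J, hJl, hJw, rfl⟩
      exact ih _ (hl ▸ hJl) J rfl (hJw.trans_lt hI)
    have reorder : ev (iterDer D I f - iterDer D (multiList α) f) = 0 :=
      ideal_le (iterDer_sub_mem_derivIdeal hD f hα)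
    rw [map_sub, sub_eq_zero] at reorder
    rw [reorder]
    exact h α (by rwa [← listWeight_multiList, ← listWeight_perm w hα])

theorem coeff_iterDer_pderiv_eq_zero_iff [IsDomain K] [CharZero K] (I : List (Fin n))
    (β : Fin n →₀ ℕ) (p : MvPolynomial (Fin n) K) :
    coeff β (iterDer pderiv I p) = 0 ↔
      coeff (β + Multiset.toFinsupp (I : Multiset (Fin n))) p = 0 := by
  induction I generalizing β with
  | nil => simp [iterDer_nil]
  | cons i I ih =>
    have hβ : (β i + 1 : K) ≠ 0 := Nat.cast_add_one_ne_zero _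
    rw [iterDer_cons, coeff_pderiv, mul_eq_zero, or_iff_left hβ, ih, ← Multiset.cons_coe,
      ← Multiset.singleton_add, map_add, Multiset.toFinsupp_singleton, add_assoc]

theorem eq_zero_of_aeval_mem_orderGE [IsDomain K] [CharZero K] (hx : IsAdaptedCoord ev D x)
    {N : ℕ} {p : MvPolynomial (Fin n) K} (hp : ∀ α ∈ p.support, multiWeight w α < N)
    (h : aeval x p ∈ orderGE ev D w N) : p = 0 := by
  by_contra hp0
  obtain ⟨α, hα, hmin⟩ := p.support.exists_min_image multiLength (support_nonempty.2 hp0)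
  have leading := h (multiList α) (by rw [listWeight_multiList]; exact hp α hα)
  rw [eval_iterDer_aeval hx _ fun β hβ => (length_multiList α).trans_le (hmin β hβ),
    coeff_iterDer_pderiv_eq_zero_iff, coe_multiList, Finsupp.toMultiset_toFinsupp,
    zero_add] at leading
  exact mem_support_iff.1 hα leading

theorem le_multiWeight_of_aeval_mem_orderGE [IsDomain K] [CharZero K] (hx : IsAdaptedCoord ev D x)
    (hxw : ∀ k, x k ∈ orderGE ev D w (w k)) {N : ℕ} {p : MvPolynomial (Fin n) K}
    (h : aeval x p ∈ orderGE ev D w N) : ∀ α ∈ p.support, N ≤ multiWeight w α := by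
  have support_sum_filter : ∀ (Q : (Fin n →₀ ℕ) → Prop) [DecidablePred Q],
      ∀ α ∈ (∑ β ∈ p.support with Q β, monomial β (p.coeff β)).support, Q α := by
    intro Q _ α hα
    obtain ⟨β, hβ, hαβ⟩ := Finset.mem_biUnion.1 (support_sum hα)
    rw [Finset.mem_singleton.1 (support_monomial_subset hαβ)]
    exact (Finset.mem_filter.1 hβ).2
  have split := (Finset.sum_filter_add_sum_filter_not p.support (fun β => multiWeight w β < N)
    fun β => monomial β (p.coeff β)).trans p.as_sum.symm
  set low := ∑ β ∈ p.support with multiWeight w β < N, monomial β (p.coeff β)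
  set high := ∑ β ∈ p.support with ¬ multiWeight w β < N, monomial β (p.coeff β)
  have hhigh : ∀ α ∈ high.support, N ≤ multiWeight w α := fun α hα =>
    not_lt.1 (support_sum_filter _ α hα)
  have hlow : low = 0 := by
    refine eq_zero_of_aeval_mem_orderGE hx (support_sum_filter fun β => multiWeight w β < N) ?_
    rw [eq_sub_of_add_eq split, map_sub]
    exact Submodule.sub_mem _ h (aeval_mem_orderGE hxw hhigh)
  rw [hlow, zero_add] at split
  rwa [← split]

end CommRing

-- The derivatives of weight `< N` embed the polynomials of weights `< N` into a space of the same
-- dimension, so every jet of derivatives is attained by a polynomial.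
theorem exists_sub_aeval_mem_orderGE [Field K] [CharZero K] [CommRing A] [Algebra K A]
    {ev : A →ₐ[K] K} {D : Fin n → Derivation K A A} {w : Fin n → ℕ} {x : Fin n → A}
    (hw : ∀ i, 1 ≤ w i) (hD : BracketCompatible D w) (hx : IsAdaptedCoord ev D x) (f : A)
    (N : ℕ) :
    ∃ p : MvPolynomial (Fin n) K, (∀ α ∈ p.support, multiWeight w α < N) ∧
      f - aeval x p ∈ orderGE ev D w N := by
  let S : Set (Fin n →₀ ℕ) := {α | multiWeight w α < N}
  have : Fintype S := (finite_multiWeight_lt hw N).fintype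
  let basis := basisRestrictSupport K S
  have : FiniteDimensional K (restrictSupport K S) := basis.finiteDimensional_of_finite
  let jet : A →ₗ[K] S → K := LinearMap.pi fun α => ev.toLinearMap ∘ₗ iterDer D (multiList α.1)
  let Φ : restrictSupport K S →ₗ[K] S → K :=
    jet ∘ₗ (aeval x).toLinearMap ∘ₗ (restrictSupport K S).subtype
  have mem_of_jet : ∀ g, jet g = 0 → g ∈ orderGE ev D w N := fun g hg =>
    mem_orderGE_of_multiList hD fun α hα => congrFun hg ⟨α, hα⟩
  have injective : Function.Injective Φ := (injective_iff_map_eq_zero Φ).2 fun p hp =>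
    Subtype.ext (eq_zero_of_aeval_mem_orderGE hx (fun _ hα => p.2 hα) (mem_of_jet _ hp))
  have finrank_eq : Module.finrank K (restrictSupport K S) = Module.finrank K (S → K) := by
    rw [Module.finrank_eq_card_basis basis, Module.finrank_fintype_fun_eq_card]
  obtain ⟨p, hp⟩ :=
    (LinearMap.injective_iff_surjective_of_finrank_eq_finrank finrank_eq).1 injective (jet f)
  refine ⟨p, fun _ hα => p.2 hα, mem_of_jet _ ?_⟩
  rw [map_sub, sub_eq_zero]
  exact hp.symm

end Derivations

/-! ### Germs of smooth functions and adapted frames near the origin -/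

section Germs

variable {E : Type*} [NormedAddCommGroup E] [NormedSpace ℝ E] {x : E}

/-- The functions that are smooth at `x`. -/
def smoothAt (x : E) : Subalgebra ℝ (E → ℝ) where
  carrier := {f | ContDiffAt ℝ ∞ f x}
  mul_mem' {f g} (hf : ContDiffAt ℝ ∞ f x) (hg : ContDiffAt ℝ ∞ g x) := hf.mul hg
  add_mem' {f g} (hf : ContDiffAt ℝ ∞ f x) (hg : ContDiffAt ℝ ∞ g x) := hf.add hg
  algebraMap_mem' c := (contDiffAt_const : ContDiffAt ℝ ∞ (fun _ : E => c) x)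

/-- The ideal of functions that vanish near `x`. -/
def nullIdeal (x : E) : Ideal (smoothAt x) where
  carrier := {f | f.1 =ᶠ[𝓝 x] 0}
  zero_mem' := Filter.EventuallyEq.rfl
  add_mem' hf hg := by simpa using Filter.EventuallyEq.add hf hg
  smul_mem' c f (hf : f.1 =ᶠ[𝓝 x] 0) := by
    filter_upwards [hf] with y hy
    simp [hy]

/-- Germs at `x` of smooth functions. -/
def SmoothGerm (x : E) : Type _ := smoothAt x ⧸ nullIdeal x

noncomputable instance (x : E) : CommRing (SmoothGerm x) :=
  inferInstanceAs (CommRing (smoothAt x ⧸ nullIdeal x))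

noncomputable instance (x : E) : Algebra ℝ (SmoothGerm x) :=
  inferInstanceAs (Algebra ℝ (smoothAt x ⧸ nullIdeal x))

/-- The germ of a smooth function. -/
noncomputable def toGerm (x : E) : smoothAt x →ₐ[ℝ] SmoothGerm x :=
  Ideal.Quotient.mkₐ ℝ (nullIdeal x)

theorem toGerm_surjective : Function.Surjective (toGerm x) := Ideal.Quotient.mkₐ_surjective _ _

theorem toGerm_eq_iff {f g : smoothAt x} : toGerm x f = toGerm x g ↔ f.1 =ᶠ[𝓝 x] g.1 :=
  (Ideal.Quotient.eq (I := nullIdeal x)).trans Filter.eventuallyEq_iff_sub.symm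

/-- The value of a germ at its base point. -/
noncomputable def evalGerm (x : E) : SmoothGerm x →ₐ[ℝ] ℝ :=
  Ideal.Quotient.liftₐ _ ((Pi.evalAlgHom ℝ (fun _ : E => ℝ) x).comp (smoothAt x).val)
    fun f (hf : f.1 =ᶠ[𝓝 x] 0) => hf.eq_of_nhds

theorem evalGerm_toGerm (f : smoothAt x) : evalGerm x (toGerm x f) = f.1 x := rfl

/-- The derivative of `f` along the vector field `Y`. -/
noncomputable def vDeriv (Y : E → E) (f : E → ℝ) : E → ℝ := fun y => fderiv ℝ f y (Y y)

theorem contDiffAt_vDeriv {Y : E → E} {f : E → ℝ} (hY : ContDiffAt ℝ ∞ Y x)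
    (hf : ContDiffAt ℝ ∞ f x) : ContDiffAt ℝ ∞ (vDeriv Y f) x :=
  (hf.fderiv_right (m := ∞) (by simp)).clm_apply hY

theorem vDeriv_congr (Y : E → E) {f g : E → ℝ} (h : f =ᶠ[𝓝 x] g) :
    vDeriv Y f =ᶠ[𝓝 x] vDeriv Y g := by
  filter_upwards [h.fderiv (𝕜 := ℝ)] with y hy
  rw [vDeriv, hy, vDeriv]

theorem eventually_contDiffAt {F : Type*} [NormedAddCommGroup F] [NormedSpace ℝ F] {f : E → F}
    (hf : ContDiffAt ℝ ∞ f x) (m : ℕ) : ∀ᶠ y in 𝓝 x, ContDiffAt ℝ m f y :=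
  (hf.of_le (by exact_mod_cast le_top)).eventually (by simp)

theorem eventually_differentiableAt {f : E → ℝ} (hf : ContDiffAt ℝ ∞ f x) :
    ∀ᶠ y in 𝓝 x, DifferentiableAt ℝ f y :=
  (eventually_contDiffAt hf 1).mono fun _ hy => hy.differentiableAt one_ne_zero

theorem vDeriv_commutator {Y Z : E → E} {f : E → ℝ} (hY : DifferentiableAt ℝ Y x)
    (hZ : DifferentiableAt ℝ Z x) (hf : ContDiffAt ℝ 2 f x) :
    vDeriv Y (vDeriv Z f) x - vDeriv Z (vDeriv Y f) x =
      fderiv ℝ f x (VectorField.lieBracket ℝ Y Z x) := by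
  have hdf : DifferentiableAt ℝ (fderiv ℝ f) x :=
    (hf.fderiv_right (m := 1) (by norm_num)).differentiableAt one_ne_zero
  have second_derivative : ∀ {V W : E → E}, DifferentiableAt ℝ W x →
      vDeriv V (vDeriv W f) x =
        fderiv ℝ (fderiv ℝ f) x (V x) (W x) + fderiv ℝ f x (fderiv ℝ W x (V x)) := by
    intro V W hW
    unfold vDeriv
    rw [fderiv_clm_apply hdf hW]
    simp [add_comm]
  rw [second_derivative hZ, second_derivative hY, (hf.isSymmSndFDerivAt (by simp)).eq (Y x) (Z x),
    VectorField.lieBracket, map_sub]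
  ring

/-- The derivative along `Y`, as a map of germs. -/
noncomputable def germDeriv (Y : E → E) (hY : ContDiffAt ℝ ∞ Y x) : SmoothGerm x → SmoothGerm x :=
  Quotient.map (fun f => (⟨vDeriv Y f.1, contDiffAt_vDeriv hY f.2⟩ : smoothAt x)) fun _ _ h =>
    Quotient.exact (toGerm_eq_iff.2 (vDeriv_congr Y (toGerm_eq_iff.1 (Quotient.sound h))))

/-- The derivation of germs defined by a smooth vector field. -/
noncomputable def germDerivation (Y : E → E) (hY : ContDiffAt ℝ ∞ Y x) :
    Derivation ℝ (SmoothGerm x) (SmoothGerm x) :=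
  Derivation.mk'
    { toFun := germDeriv Y hY
      map_add' := toGerm_surjective.forall₂.2 fun f g => toGerm_eq_iff.2 <| by
        filter_upwards [eventually_differentiableAt f.2, eventually_differentiableAt g.2]
          with y hf hg
        simp [vDeriv, fderiv_add hf hg]
      map_smul' := fun c => toGerm_surjective.forall.2 fun f => toGerm_eq_iff.2 <| by
        filter_upwards [eventually_differentiableAt f.2] with y hf
        simp [vDeriv, fderiv_const_smul hf] }
    (toGerm_surjective.forall₂.2 fun f g => toGerm_eq_iff.2 <| by
      filter_upwards [eventually_differentiableAt f.2, eventually_differentiableAt g.2]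
        with y hf hg
      simp [vDeriv, fderiv_mul hf hg])

theorem germDerivation_toGerm {Y : E → E} (hY : ContDiffAt ℝ ∞ Y x) (f : smoothAt x) :
    germDerivation Y hY (toGerm x f) = toGerm x ⟨vDeriv Y f.1, contDiffAt_vDeriv hY f.2⟩ := rfl

end Germs

section Polynomials

variable {n : ℕ}

theorem contDiffAt_coord (k : Fin n) (x : Euc n) : ContDiffAt ℝ ∞ (fun y : Euc n => y k) x :=
  (EuclideanSpace.proj (𝕜 := ℝ) k).contDiff.contDiffAt

theorem fderiv_coord (k : Fin n) (x v : Euc n) : fderiv ℝ (fun y : Euc n => y k) x v = v k :=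
  congrArg (fun L => L v) (EuclideanSpace.proj (𝕜 := ℝ) k : Euc n →L[ℝ] ℝ).fderiv

theorem sum_smul_single (a : Euc n) : ∑ k, a k • EuclideanSpace.single k (1 : ℝ) = a := by
  ext i
  simp [Pi.single_apply]

theorem clm_ext_single {F : Type*} [NormedAddCommGroup F] [NormedSpace ℝ F]
    {L L' : Euc n →L[ℝ] F}
    (h : ∀ j, L (EuclideanSpace.single j 1) = L' (EuclideanSpace.single j 1)) : L = L' := by
  ext v
  rw [← sum_smul_single v, map_sum, map_sum]
  exact Finset.sum_congr rfl fun j _ => by rw [map_smul, map_smul, h]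

/-- The polynomial function on `ℝⁿ` defined by `p`. -/
noncomputable def polyFun (p : MvPolynomial (Fin n) ℝ) (y : Euc n) : ℝ :=
  MvPolynomial.eval (fun i => y i) p

theorem contDiff_polyFun (p : MvPolynomial (Fin n) ℝ) : ContDiff ℝ ∞ (polyFun p) :=
  contDiff_iff_contDiffAt.2 fun x => (AnalyticAt.aeval_mvPolynomial (z := x)
    (fun i => (EuclideanSpace.proj (𝕜 := ℝ) i : Euc n →L[ℝ] ℝ).analyticAt x) p).contDiffAt

/-- The coordinate functions, as functions that are smooth at the origin. -/
def coordAt (k : Fin n) : smoothAt (0 : Euc n) := ⟨fun y => y k, contDiffAt_coord k 0⟩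

theorem aeval_toGerm_coordAt (p : MvPolynomial (Fin n) ℝ) :
    MvPolynomial.aeval (fun k => toGerm 0 (coordAt k)) p =
      toGerm 0 ⟨polyFun p, (contDiff_polyFun p).contDiffAt⟩ := by
  have h : MvPolynomial.aeval coordAt p =
      (⟨polyFun p, (contDiff_polyFun p).contDiffAt⟩ : smoothAt (0 : Euc n)) := by
    ext y
    exact MvPolynomial.comp_aeval_apply _
      ((Pi.evalAlgHom ℝ (fun _ : Euc n => ℝ) y).comp (smoothAt 0).val) p
  rw [← h, MvPolynomial.comp_aeval_apply]

end Polynomials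

section Frames

variable {n : ℕ} {w : Fin n → ℕ} {Y : Fin n → Euc n → Euc n}

/-- Iterated derivatives along vector fields of `ℝⁿ`; in coordinates, these are the derivatives
`iterDeriv` on a manifold. -/
noncomputable def iterVDeriv (Y : Fin n → Euc n → Euc n) (I : List (Fin n)) (f : Euc n → ℝ) :
    Euc n → ℝ := I.foldr (fun i g => vDeriv (Y i) g) f

/-- The smooth function `f` on `ℝⁿ` has order at least `N` at the origin. -/
def VanishesToOrder (Y : Fin n → Euc n → Euc n) (w : Fin n → ℕ) (N : ℕ) (f : Euc n → ℝ) : Prop :=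
  ∀ I, listWeight w I < N → iterVDeriv Y I f 0 = 0

theorem contDiffAt_iterVDeriv (hY : ∀ i, ContDiffAt ℝ ∞ (Y i) 0) {f : Euc n → ℝ}
    (hf : ContDiffAt ℝ ∞ f 0) (I : List (Fin n)) : ContDiffAt ℝ ∞ (iterVDeriv Y I f) 0 := by
  induction I with
  | nil => exact hf
  | cons i I ih => exact contDiffAt_vDeriv (hY i) ih

theorem iterVDeriv_append_singleton (Y : Fin n → Euc n → Euc n) (I : List (Fin n)) (i : Fin n)
    (f : Euc n → ℝ) : iterVDeriv Y (I ++ [i]) f = iterVDeriv Y I (vDeriv (Y i) f) := by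
  simp [iterVDeriv]

theorem vanishesToOrder_iff (hY : ∀ i, ContDiffAt ℝ ∞ (Y i) 0) {f : Euc n → ℝ}
    (hf : ContDiffAt ℝ ∞ f 0) {N : ℕ} : VanishesToOrder Y w N f ↔
      toGerm (0 : Euc n) ⟨f, hf⟩ ∈
        orderGE (evalGerm (0 : Euc n)) (fun i => germDerivation (Y i) (hY i)) w N := by
  have iterDer_toGerm : ∀ I, iterDer (fun i => germDerivation (Y i) (hY i)) I (toGerm 0 ⟨f, hf⟩) =
      toGerm 0 ⟨iterVDeriv Y I f, contDiffAt_iterVDeriv hY hf I⟩ := by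
    intro I
    induction I with
    | nil => rfl
    | cons i I ih => rw [iterDer_cons, ih, germDerivation_toGerm]; rfl
  refine forall₂_congr fun I _ => ?_
  rw [iterDer_toGerm, evalGerm_toGerm]

theorem VanishesToOrder.sub (hY : ∀ i, ContDiffAt ℝ ∞ (Y i) 0) {f g : Euc n → ℝ}
    (hf : ContDiffAt ℝ ∞ f 0) (hg : ContDiffAt ℝ ∞ g 0) {N : ℕ} (hfN : VanishesToOrder Y w N f)
    (hgN : VanishesToOrder Y w N g) : VanishesToOrder Y w N fun y => f y - g y := by
  rw [vanishesToOrder_iff hY hf] at hfN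
  rw [vanishesToOrder_iff hY hg] at hgN
  exact (vanishesToOrder_iff hY (hf.sub hg)).2 (Submodule.sub_mem _ hfN hgN)

theorem VanishesToOrder.add (hY : ∀ i, ContDiffAt ℝ ∞ (Y i) 0) {f g : Euc n → ℝ}
    (hf : ContDiffAt ℝ ∞ f 0) (hg : ContDiffAt ℝ ∞ g 0) {N : ℕ} (hfN : VanishesToOrder Y w N f)
    (hgN : VanishesToOrder Y w N g) : VanishesToOrder Y w N fun y => f y + g y := by
  rw [vanishesToOrder_iff hY hf] at hfN
  rw [vanishesToOrder_iff hY hg] at hgN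
  exact (vanishesToOrder_iff hY (hf.add hg)).2 (Submodule.add_mem _ hfN hgN)

theorem VanishesToOrder.of_one_weight (hw : ∀ i, 1 ≤ w i) {N : ℕ} {f : Euc n → ℝ}
    (h : VanishesToOrder Y (fun _ => 1) N f) : VanishesToOrder Y w N f := fun I hI =>
  h I (by rw [listWeight_one]; exact (length_le_listWeight hw I).trans_lt hI)

/-- Smooth vector fields near the origin of `ℝⁿ` that equal the standard basis at the origin. -/
structure IsStandardFrame (Y : Fin n → Euc n → Euc n) : Prop where
  smooth : ∀ i, ContDiffAt ℝ ∞ (Y i) 0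
  eq_single : ∀ j, Y j 0 = EuclideanSpace.single j (1 : ℝ)

/-- The linear map `(a₁, …, aₙ) ↦ ∑ a_k Y_k(y)`. -/
noncomputable def frameMap (Y : Fin n → Euc n → Euc n) (y : Euc n) : Euc n →L[ℝ] Euc n :=
  ∑ k, (EuclideanSpace.proj k : Euc n →L[ℝ] ℝ).smulRight (Y k y)

theorem frameMap_apply (Y : Fin n → Euc n → Euc n) (y a : Euc n) :
    frameMap Y y a = ∑ k, a k • Y k y := by
  simp [frameMap]

theorem frameMap_single (Y : Fin n → Euc n → Euc n) (y : Euc n) (k : Fin n) :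
    frameMap Y y (EuclideanSpace.single k 1) = Y k y := by
  simp [frameMap_apply]

namespace IsStandardFrame

theorem contDiffAt_frameMap (hY : IsStandardFrame Y) : ContDiffAt ℝ ∞ (frameMap Y) 0 :=
  ContDiffAt.sum fun k _ =>
    (ContinuousLinearMap.smulRightL ℝ (Euc n) (Euc n)
      (EuclideanSpace.proj k : Euc n →L[ℝ] ℝ)).contDiff.contDiffAt.comp 0 (hY.smooth k)

theorem frameMap_zero (hY : IsStandardFrame Y) :
    frameMap Y 0 = (ContinuousLinearEquiv.refl ℝ (Euc n) : Euc n →L[ℝ] Euc n) := by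
  ext1 a
  simp only [frameMap_apply, hY.eq_single, sum_smul_single]
  rfl

theorem eventually_isInvertible_frameMap (hY : IsStandardFrame Y) :
    ∀ᶠ y in 𝓝 0, (frameMap Y y).IsInvertible :=
  hY.contDiffAt_frameMap.continuousAt.eventually
    (hY.frameMap_zero ▸ ContinuousLinearEquiv.nhds (ContinuousLinearEquiv.refl ℝ (Euc n)))

theorem contDiffAt_inverse_frameMap (hY : IsStandardFrame Y) :
    ContDiffAt ℝ ∞ (fun y => (frameMap Y y).inverse) 0 := by
  have h := contDiffAt_map_inverse (𝕜 := ℝ) (n := ∞) (ContinuousLinearEquiv.refl ℝ (Euc n))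
  rw [← hY.frameMap_zero] at h
  exact h.comp 0 hY.contDiffAt_frameMap

theorem isAdaptedCoord (hY : IsStandardFrame Y) :
    IsAdaptedCoord (evalGerm 0) (fun i => germDerivation (Y i) (hY.smooth i))
      (fun k => toGerm 0 (coordAt k)) where
  eval k := by
    rw [evalGerm_toGerm]
    rfl
  deriv j k := by
    rw [germDerivation_toGerm, evalGerm_toGerm]
    simp only [coordAt, vDeriv, fderiv_coord, hY.eq_single]
    simp [eq_comm]

theorem eq_zero_of_vanishesToOrder (hY : IsStandardFrame Y) {N : ℕ} {p : MvPolynomial (Fin n) ℝ}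
    (hp : ∀ α ∈ p.support, multiWeight w α < N) (h : VanishesToOrder Y w N (polyFun p)) :
    p = 0 := by
  refine eq_zero_of_aeval_mem_orderGE hY.isAdaptedCoord hp ?_
  rw [aeval_toGerm_coordAt]
  exact (vanishesToOrder_iff hY.smooth _).1 h

theorem coeff_single_eq_vDeriv_polyFun (hY : IsStandardFrame Y) (p : MvPolynomial (Fin n) ℝ)
    (j : Fin n) : p.coeff (Finsupp.single j 1) = vDeriv (Y j) (polyFun p) 0 := by
  rw [coeff_single_eq_eval_derivation hY.isAdaptedCoord, aeval_toGerm_coordAt,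
    germDerivation_toGerm, evalGerm_toGerm]

theorem coeff_single_eq_vDeriv (hY : IsStandardFrame Y) {f : Euc n → ℝ} (hf : ContDiffAt ℝ ∞ f 0)
    {p : MvPolynomial (Fin n) ℝ} {N : ℕ} (h : VanishesToOrder Y w N fun y => f y - polyFun p y)
    {j : Fin n} (hj : w j < N) : p.coeff (Finsupp.single j 1) = vDeriv (Y j) f 0 := by
  have hderiv : vDeriv (Y j) (fun y => f y - polyFun p y) 0 = 0 := h [j] (by simpa [listWeight])
  rw [vDeriv, fderiv_fun_sub (hf.differentiableAt (by simp))
    ((contDiff_polyFun p).contDiffAt.differentiableAt (by simp))] at hderiv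
  rw [hY.coeff_single_eq_vDeriv_polyFun]
  exact (sub_eq_zero.1 hderiv).symm

theorem vanishesToOrder_polyFun_iff (hY : IsStandardFrame Y)
    (hx : ∀ k, VanishesToOrder Y w (w k) fun y => y k) {p : MvPolynomial (Fin n) ℝ} {N : ℕ} :
    VanishesToOrder Y w N (polyFun p) ↔ ∀ α ∈ p.support, N ≤ multiWeight w α := by
  have hxw : ∀ k, toGerm 0 (coordAt k) ∈
      orderGE (evalGerm 0) (fun i => germDerivation (Y i) (hY.smooth i)) w (w k) := fun k =>
    (vanishesToOrder_iff hY.smooth (contDiffAt_coord k 0)).1 (hx k)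
  rw [vanishesToOrder_iff hY.smooth (contDiff_polyFun p).contDiffAt, ← aeval_toGerm_coordAt]
  exact ⟨le_multiWeight_of_aeval_mem_orderGE hY.isAdaptedCoord hxw, aeval_mem_orderGE hxw⟩

end IsStandardFrame

/-- A standard frame near the origin of `ℝⁿ` whose brackets `[Y_i, Y_j]` are combinations of the
`Y_k` with `w_k ≤ w_i + w_j`: the coordinate form of a frame of weights `w`. -/
structure IsAdaptedFrame (w : Fin n → ℕ) (Y : Fin n → Euc n → Euc n) : Prop extends
    IsStandardFrame Y where
  bracket : ∀ i j, ∀ᶠ y in 𝓝 0, VectorField.lieBracket ℝ (Y i) (Y j) y ∈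
    Submodule.span ℝ ((fun k => Y k y) '' {k | w k ≤ w i + w j})

theorem IsStandardFrame.isAdaptedFrame_one (hY : IsStandardFrame Y) :
    IsAdaptedFrame (fun _ => 1) Y where
  toIsStandardFrame := hY
  bracket i j := by
    filter_upwards [hY.eventually_isInvertible_frameMap] with y hy
    rw [← hy.self_apply_inverse (VectorField.lieBracket ℝ (Y i) (Y j) y), frameMap_apply]
    exact Submodule.sum_mem _ fun k _ =>
      Submodule.smul_mem _ _ (Submodule.subset_span ⟨k, by simp, rfl⟩)

theorem contDiffAt_lieBracket {E : Type*} [NormedAddCommGroup E] [NormedSpace ℝ E] {x : E}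
    {V W : E → E} (hV : ContDiffAt ℝ ∞ V x) (hW : ContDiffAt ℝ ∞ W x) :
    ContDiffAt ℝ ∞ (VectorField.lieBracket ℝ V W) x :=
  ((hW.fderiv_right (m := ∞) (by simp)).clm_apply hV).sub
    ((hV.fderiv_right (m := ∞) (by simp)).clm_apply hW)

theorem inverse_frameMap_eq_zero {y v : Euc n} (hy : (frameMap Y y).IsInvertible)
    {s : Set (Fin n)} (hv : v ∈ Submodule.span ℝ ((fun k => Y k y) '' s)) {k : Fin n}
    (hk : k ∉ s) : (frameMap Y y).inverse v k = 0 := by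
  induction hv using Submodule.span_induction with
  | mem v hv =>
    obtain ⟨l, hl, rfl⟩ := hv
    have hkl : k ≠ l := fun h => hk (h ▸ hl)
    simp [← frameMap_single, hy.inverse_apply_self, hkl]
  | zero => simp
  | add u v _ _ hu hv => simp [hu, hv]
  | smul c v _ hv => simp [hv]

namespace IsAdaptedFrame

theorem bracketCompatible (hY : IsAdaptedFrame w Y) :
    BracketCompatible (fun i => germDerivation (Y i) (hY.smooth i)) w := by
  classical
  intro i j
  let L (k : Fin n) : smoothAt (0 : Euc n) :=
    ⟨fun y => (frameMap Y y).inverse (VectorField.lieBracket ℝ (Y i) (Y j) y) k,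
      (contDiffAt_coord k _).comp 0 (hY.contDiffAt_inverse_frameMap.clm_apply
        (contDiffAt_lieBracket (hY.smooth i) (hY.smooth j)))⟩
  have expand : ⁅germDerivation (Y i) (hY.smooth i), germDerivation (Y j) (hY.smooth j)⁆ =
      ∑ k, toGerm 0 (L k) • germDerivation (Y k) (hY.smooth k) := by
    refine Derivation.ext (toGerm_surjective.forall.2 fun f => ?_)
    have hsum : (∑ k, toGerm 0 (L k) • germDerivation (Y k) (hY.smooth k)) (toGerm 0 f) =
        toGerm 0 (∑ k, L k * ⟨vDeriv (Y k) f.1, contDiffAt_vDeriv (hY.smooth k) f.2⟩) := by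
      rw [map_sum, ← Derivation.coeFnAddMonoidHom_apply, map_sum, Finset.sum_apply]
      exact Finset.sum_congr rfl fun k _ => (map_mul (toGerm 0) _ _).symm
    rw [hsum, Derivation.commutator_apply]
    simp only [germDerivation_toGerm, ← map_sub]
    rw [toGerm_eq_iff]
    filter_upwards [hY.eventually_isInvertible_frameMap, eventually_contDiffAt (hY.smooth i) 1,
      eventually_contDiffAt (hY.smooth j) 1, eventually_contDiffAt f.2 2] with y hy hi hj hf
    have hbr := vDeriv_commutator (hi.differentiableAt one_ne_zero)
      (hj.differentiableAt one_ne_zero) hf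
    rw [← hy.self_apply_inverse (VectorField.lieBracket ℝ (Y i) (Y j) y), frameMap_apply,
      map_sum] at hbr
    simpa [L, vDeriv] using hbr
  rw [expand]
  refine Submodule.sum_mem _ fun k _ => ?_
  by_cases hk : w k ≤ w i + w j
  · exact Submodule.smul_mem _ _ (Submodule.subset_span ⟨k, hk, rfl⟩)
  · have hL : toGerm 0 (L k) = toGerm 0 0 := by
      rw [toGerm_eq_iff]
      filter_upwards [hY.eventually_isInvertible_frameMap, hY.bracket i j] with y hy hbr
      exact inverse_frameMap_eq_zero hy hbr hk
    rw [hL, map_zero, zero_smul]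
    exact Submodule.zero_mem _

theorem exists_polyFun (hY : IsAdaptedFrame w Y) (hw : ∀ i, 1 ≤ w i)
    {f : Euc n → ℝ} (hf : ContDiffAt ℝ ∞ f 0) (N : ℕ) :
    ∃ p : MvPolynomial (Fin n) ℝ, (∀ α ∈ p.support, multiWeight w α < N) ∧
      VanishesToOrder Y w N fun y => f y - polyFun p y := by
  obtain ⟨p, hp, h⟩ := exists_sub_aeval_mem_orderGE hw hY.bracketCompatible hY.isAdaptedCoord
    (toGerm 0 ⟨f, hf⟩) N
  rw [aeval_toGerm_coordAt, ← map_sub] at h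
  exact ⟨p, hp, (vanishesToOrder_iff hY.smooth (hf.sub (contDiff_polyFun p).contDiffAt)).2 h⟩

end IsAdaptedFrame

end Frames

/-! ### Orders of vanishing and growth with respect to a pseudo-norm -/

theorem isBigO_pow_succ_of_fderiv {E F : Type*} [NormedAddCommGroup E] [NormedSpace ℝ E]
    [NormedAddCommGroup F] [NormedSpace ℝ F] {f : E → F} {K : ℕ} (hf0 : f 0 = 0)
    (hf : ∀ᶠ y in 𝓝 0, DifferentiableAt ℝ f y)
    (h : fderiv ℝ f =O[𝓝 0] fun y => ‖y‖ ^ K) : f =O[𝓝 0] fun y => ‖y‖ ^ (K + 1) := by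
  obtain ⟨C, hC0, hC⟩ := h.exists_nonneg
  obtain ⟨ε, hε, hball⟩ := Metric.eventually_nhds_iff_ball.1 (hf.and hC.bound)
  refine IsBigO.of_bound C ?_
  filter_upwards [Metric.ball_mem_nhds 0 hε] with y hy
  have mem_ball : ∀ z ∈ Metric.closedBall (0 : E) ‖y‖, z ∈ Metric.ball (0 : E) ε := fun z hz =>
    Metric.closedBall_subset_ball (mem_ball_zero_iff.1 hy) hz
  have fderiv_le : ∀ z ∈ Metric.closedBall (0 : E) ‖y‖, ‖fderiv ℝ f z‖ ≤ C * ‖y‖ ^ K := by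
    intro z hz
    refine (hball z (mem_ball z hz)).2.trans ?_
    rw [norm_pow, norm_norm]
    gcongr
    exact mem_closedBall_zero_iff.1 hz
  have mean_value := (convex_closedBall (0 : E) ‖y‖).norm_image_sub_le_of_norm_fderiv_le
    (𝕜 := ℝ) (x := 0) (y := y) (fun z hz => (hball z (mem_ball z hz)).1) fderiv_le
    (by simp) (by simp)
  simpa [hf0, pow_succ, mul_assoc] using mean_value

section Frames

variable {n : ℕ} {Y : Fin n → Euc n → Euc n}

theorem IsStandardFrame.eventually_fderiv_eq (hY : IsStandardFrame Y) (f : Euc n → ℝ) :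
    fderiv ℝ f =ᶠ[𝓝 0] fun y => ∑ k, vDeriv (Y k) f y •
      (EuclideanSpace.proj k : Euc n →L[ℝ] ℝ).comp (frameMap Y y).inverse := by
  filter_upwards [hY.eventually_isInvertible_frameMap] with y hy
  ext1 v
  conv_lhs => rw [← hy.self_apply_inverse v, frameMap_apply, map_sum]
  simp [vDeriv, mul_comm]

theorem IsStandardFrame.isBigO_norm_pow (hY : IsStandardFrame Y) (K : ℕ) {f : Euc n → ℝ}
    (hf : ContDiffAt ℝ ∞ f 0) (h : VanishesToOrder Y (fun _ => 1) K f) :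
    f =O[𝓝 0] fun y => ‖y‖ ^ K := by
  induction K generalizing f with
  | zero => simpa using hf.continuousAt.tendsto.isBigO_one ℝ
  | succ K ih =>
    refine isBigO_pow_succ_of_fderiv (h [] (by simp [listWeight]))
      (eventually_differentiableAt hf)
      ((hY.eventually_fderiv_eq f).trans_isBigO (IsBigO.fun_sum fun k _ => ?_))
    have hderiv : vDeriv (Y k) f =O[𝓝 0] fun y => ‖y‖ ^ K :=
      ih (contDiffAt_vDeriv (hY.smooth k) hf) fun I hI => by
        rw [← iterVDeriv_append_singleton]
        exact h _ (by rw [listWeight_append_singleton]; omega)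
    have hinv : (fun y => (EuclideanSpace.proj k : Euc n →L[ℝ] ℝ).comp (frameMap Y y).inverse)
        =O[𝓝 0] fun _ => (1 : ℝ) :=
      (continuousAt_const.clm_comp
        hY.contDiffAt_inverse_frameMap.continuousAt).tendsto.isBigO_one ℝ
    simpa using hderiv.smul hinv

end Frames

section Dilation

variable {n : ℕ} {w : Fin n → ℕ}

theorem dilation_apply (t : ℝ) (x : Euc n) (k : Fin n) : dilation w t x k = t ^ w k * x k := rfl

theorem dilation_zero (hw : ∀ i, 1 ≤ w i) (x : Euc n) : dilation w 0 x = 0 := by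
  ext k
  simp [dilation_apply, zero_pow (Nat.one_le_iff_ne_zero.1 (hw k))]

theorem dilation_one (x : Euc n) : dilation w 1 x = x := by
  ext k
  simp [dilation_apply]

theorem dilation_dilation (s t : ℝ) (x : Euc n) :
    dilation w s (dilation w t x) = dilation w (s * t) x := by
  ext k
  simp [dilation_apply, mul_pow, mul_assoc]

theorem continuous_dilation : Continuous fun z : ℝ × Euc n => dilation w z.1 z.2 := by
  unfold dilation
  fun_prop

theorem polyFun_dilation {p : MvPolynomial (Fin n) ℝ} {m : ℕ}
    (hp : ∀ α ∈ p.support, multiWeight w α = m) (t : ℝ) (x : Euc n) :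
    polyFun p (dilation w t x) = t ^ m * polyFun p x := by
  rw [polyFun, polyFun, MvPolynomial.eval_eq', MvPolynomial.eval_eq', Finset.mul_sum]
  refine Finset.sum_congr rfl fun α hα => ?_
  simp only [dilation_apply, mul_pow, Finset.prod_mul_distrib, ← pow_mul,
    Finset.prod_pow_eq_pow_sum, ← hp α hα, multiWeight]
  ring

end Dilation

namespace IsPseudoNorm

variable {n : ℕ} {w : Fin n → ℕ} {N : Euc n → ℝ}

theorem zero (hN : IsPseudoNorm w N) (hw : ∀ i, 1 ≤ w i) : N 0 = 0 := by
  simpa [dilation_zero hw] using hN.dilation 0 0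

theorem isCompact_unit_level (hN : IsPseudoNorm w N) (hw : ∀ i, 1 ≤ w i) :
    IsCompact {y | N y = 1} := by
  obtain ⟨c, hc, hcN⟩ := (isCompact_sphere (0 : Euc n) 1).exists_forall_le'
    hN.continuous.continuousOn (a := 0)
    (fun x hx => hN.pos x (ne_zero_of_mem_unit_sphere ⟨x, hx⟩))
  have isCompact_dilates : IsCompact ((fun z : ℝ × Euc n => CarnotMfd.dilation w z.1⁻¹ z.2) ''
      Set.Icc c 1 ×ˢ Metric.sphere 0 1) := by
    refine (isCompact_Icc.prod (isCompact_sphere _ _)).image_of_continuousOn ?_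
    exact continuous_dilation.comp_continuousOn ((continuousOn_fst.inv₀ fun z hz =>
      (hc.trans_le hz.1.1).ne').prodMk continuousOn_snd)
  refine ((isCompact_closedBall (0 : Euc n) 1).union isCompact_dilates).of_isClosed_subset
    (isClosed_eq hN.continuous continuous_const) fun y (hy : N y = 1) => ?_
  by_cases hy1 : ‖y‖ ≤ 1
  · exact Or.inl (mem_closedBall_zero_iff.2 hy1)
  · right
    obtain ⟨t, ht, hty⟩ : (1 : ℝ) ∈ (fun t => ‖CarnotMfd.dilation w t y‖) '' Set.Icc 0 1 := by
      refine intermediate_value_Icc zero_le_one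
        (continuous_dilation.comp (.prodMk_left y)).norm.continuousOn ⟨?_, ?_⟩
      · simp [dilation_zero hw]
      · simpa [dilation_one] using (not_le.1 hy1).le
    have hct : c ≤ t := by
      simpa [hN.dilation, hy, abs_of_nonneg ht.1] using
        hcN (CarnotMfd.dilation w t y) (by simpa using hty)
    refine ⟨(t, CarnotMfd.dilation w t y), ⟨⟨hct, ht.2⟩, by simpa using hty⟩, ?_⟩
    simp [dilation_dilation, inv_mul_cancel₀ (hc.trans_le hct).ne', dilation_one]

theorem exists_eq_dilation (hN : IsPseudoNorm w N) (hw : ∀ i, 1 ≤ w i) (x : Euc n) :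
    ∃ y ∈ insert 0 {y | N y = 1}, x = CarnotMfd.dilation w (N x) y := by
  by_cases hx : x = 0
  · exact ⟨0, Set.mem_insert _ _, by rw [hx, hN.zero hw, dilation_zero hw]⟩
  · have hpos := hN.pos x hx
    refine ⟨CarnotMfd.dilation w (N x)⁻¹ x, Set.mem_insert_of_mem _ ?_, ?_⟩
    · rw [Set.mem_ofPred_eq, hN.dilation, abs_of_pos (inv_pos.2 hpos), inv_mul_cancel₀ hpos.ne']
    · rw [dilation_dilation, mul_inv_cancel₀ hpos.ne', dilation_one]

theorem isBigO_of_homogeneous (hN : IsPseudoNorm w N) (hw : ∀ i, 1 ≤ w i) {g : Euc n → ℝ}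
    (hg : Continuous g) {m : ℕ} (hgm : ∀ t x, g (CarnotMfd.dilation w t x) = t ^ m * g x) :
    g =O[𝓝 0] fun x => N x ^ m := by
  obtain ⟨B, hB⟩ := ((hN.isCompact_unit_level hw).insert 0).exists_bound_of_continuousOn
    hg.continuousOn
  refine IsBigO.of_bound B (Eventually.of_forall fun x => ?_)
  obtain ⟨y, hy, hxy⟩ := hN.exists_eq_dilation hw x
  calc ‖g x‖ = ‖g y‖ * ‖N x ^ m‖ := by rw [hxy, hgm, ← hxy, norm_mul, mul_comm]
    _ ≤ B * ‖N x ^ m‖ := by gcongr; exact hB y hy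

theorem isBigO_pow (hN : IsPseudoNorm w N) {a b : ℕ} (hab : a ≤ b) :
    (fun x => N x ^ b) =O[𝓝 0] fun x => N x ^ a := by
  have h : (fun x => N x ^ (b - a)) =O[𝓝 0] fun _ => (1 : ℝ) :=
    ((hN.continuous.pow _).tendsto 0).isBigO_one ℝ
  simpa [← pow_add, Nat.add_sub_cancel' hab] using
    (isBigO_refl (fun x => N x ^ a) (𝓝 0)).mul h

theorem isBigO_norm (hN : IsPseudoNorm w N) (hw : ∀ i, 1 ≤ w i) :
    (fun x : Euc n => ‖x‖) =O[𝓝 0] N := by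
  have hcoord : ∀ k, (fun x : Euc n => ‖x k‖) =O[𝓝 0] N := fun k => by
    have h : (fun x : Euc n => x k) =O[𝓝 0] fun x => N x ^ w k :=
      hN.isBigO_of_homogeneous hw (EuclideanSpace.proj k).continuous fun t x =>
        dilation_apply t x k
    simpa only [pow_one] using (h.trans (hN.isBigO_pow (hw k))).norm_left
  refine IsBigO.trans (IsBigO.of_norm_le fun x => ?_)
    (IsBigO.fun_sum (s := Finset.univ) fun k _ => hcoord k)
  calc ‖‖x‖‖ = ‖∑ k, x k • EuclideanSpace.single k (1 : ℝ)‖ := by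
        rw [norm_norm, sum_smul_single]
    _ ≤ ∑ k, ‖x k • EuclideanSpace.single k (1 : ℝ)‖ := norm_sum_le _ _
    _ = ∑ k, ‖x k‖ := by simp only [norm_smul, PiLp.norm_single, norm_one, mul_one]

theorem isBigO_polyFun (hN : IsPseudoNorm w N) (hw : ∀ i, 1 ≤ w i)
    {p : MvPolynomial (Fin n) ℝ} {m : ℕ} (hp : ∀ α ∈ p.support, m ≤ multiWeight w α) :
    polyFun p =O[𝓝 0] fun x => N x ^ m := by
  have hsum : polyFun p =
      fun x => ∑ α ∈ p.support, polyFun (MvPolynomial.monomial α (p.coeff α)) x := by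
    ext x
    exact (congrArg _ p.as_sum).trans (map_sum _ _ _)
  rw [hsum]
  refine IsBigO.fun_sum fun α hα => (hN.isBigO_of_homogeneous hw
    (contDiff_polyFun _).continuous (polyFun_dilation fun β hβ => ?_)).trans
    (hN.isBigO_pow (hp α hα))
  rw [Finset.mem_singleton.1 (MvPolynomial.support_monomial_subset hβ)]

end IsPseudoNorm

theorem X_pow_dvd_of_isBigO {Q : Polynomial ℝ} {m : ℕ}
    (h : (fun s => Q.eval s) =O[𝓝[≠] 0] fun s => s ^ m) : Polynomial.X ^ m ∣ Q := by
  induction m generalizing Q with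
  | zero => exact one_dvd Q
  | succ m ih =>
    have hlim : Tendsto (fun s : ℝ => s ^ (m + 1)) (𝓝[≠] 0) (𝓝 0) := by
      simpa using ((continuous_pow (m + 1)).tendsto (0 : ℝ)).mono_left nhdsWithin_le_nhds
    have hQ0 : Q.eval 0 = 0 := tendsto_nhds_unique
      ((Q.continuous.tendsto 0).mono_left nhdsWithin_le_nhds) (h.trans_tendsto hlim)
    obtain ⟨R, rfl⟩ : Polynomial.X ∣ Q := by
      rwa [Polynomial.X_dvd_iff, Polynomial.coeff_zero_eq_eval_zero]
    rw [pow_succ']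
    refine mul_dvd_mul_left _ (ih ?_)
    refine ((isBigO_refl (fun s : ℝ => s⁻¹) (𝓝[≠] 0)).mul h).congr' ?_ ?_ <;>
      filter_upwards [self_mem_nhdsWithin] with s hs
    · rw [Polynomial.eval_mul, Polynomial.eval_X, inv_mul_cancel_left₀ hs]
    · rw [pow_succ', inv_mul_cancel_left₀ hs]

section Privileged

variable {n : ℕ} {w : Fin n → ℕ} {N : Euc n → ℝ} {Y : Fin n → Euc n → Euc n}

theorem IsPseudoNorm.polyFun_weightedHomogeneousComponent_eq_zero (hN : IsPseudoNorm w N)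
    (hw : ∀ i, 1 ≤ w i) {p : MvPolynomial (Fin n) ℝ} {l m : ℕ}
    (h : polyFun p =O[𝓝 0] fun x => N x ^ m) (hl : l < m) (x : Euc n) :
    polyFun (MvPolynomial.weightedHomogeneousComponent w l p) x = 0 := by
  let Q : Polynomial ℝ := ∑ β ∈ p.support,
    Polynomial.monomial (multiWeight w β) (p.coeff β * ∏ i, x i ^ β i)
  have eval_Q : ∀ s, Q.eval s = polyFun p (CarnotMfd.dilation w s x) := by
    intro s
    rw [Polynomial.eval_finsetSum, polyFun, MvPolynomial.eval_eq']
    refine Finset.sum_congr rfl fun β _ => ?_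
    simp only [Polynomial.eval_monomial, dilation_apply, mul_pow, Finset.prod_mul_distrib,
      ← pow_mul, Finset.prod_pow_eq_pow_sum, multiWeight]
    ring
  have htend : Tendsto (fun s => CarnotMfd.dilation w s x) (𝓝 0) (𝓝 0) := by
    simpa [dilation_zero hw, Function.comp_def] using
      (continuous_dilation (w := w).comp (.prodMk_left x)).tendsto (0 : ℝ)
  have hQ : (fun s => Q.eval s) =O[𝓝 0] fun s => s ^ m := by
    simp only [eval_Q]
    refine (h.comp_tendsto htend).trans
      (IsBigO.of_bound (N x ^ m) (Eventually.of_forall fun s => ?_))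
    simp [hN.dilation, mul_pow, abs_of_nonneg (hN.nonneg _), mul_comm]
  have hcoeff := Polynomial.X_pow_dvd_iff.1
    (X_pow_dvd_of_isBigO (hQ.mono nhdsWithin_le_nhds)) l hl
  simpa [Q, polyFun, Polynomial.finsetSum_coeff, Polynomial.coeff_monomial, Finset.sum_filter,
    MvPolynomial.weightedHomogeneousComponent_apply, MvPolynomial.eval_monomial,
    multiWeight_eq_weight, Finsupp.prod_fintype, apply_ite] using hcoeff

theorem IsPseudoNorm.isBigO_polyFun_iff (hN : IsPseudoNorm w N) (hw : ∀ i, 1 ≤ w i)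
    {p : MvPolynomial (Fin n) ℝ} {m : ℕ} :
    (polyFun p =O[𝓝 0] fun x => N x ^ m) ↔ ∀ α ∈ p.support, m ≤ multiWeight w α := by
  refine ⟨fun h α hα => ?_, hN.isBigO_polyFun hw⟩
  by_contra! hαm
  have component_eq_zero :
      MvPolynomial.weightedHomogeneousComponent w (multiWeight w α) p = 0 :=
    MvPolynomial.funext fun x => by
      simpa [polyFun] using
        hN.polyFun_weightedHomogeneousComponent_eq_zero hw h hαm (WithLp.toLp 2 x)
  have hcoeff := congrArg (MvPolynomial.coeff α) component_eq_zero
  rw [MvPolynomial.coeff_weightedHomogeneousComponent, ← multiWeight_eq_weight, if_pos rfl]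
    at hcoeff
  exact MvPolynomial.mem_support_iff.1 hα hcoeff

theorem IsStandardFrame.vanishesToOrder_iff_isBigO (hY : IsStandardFrame Y) (hw : ∀ i, 1 ≤ w i)
    (hN : IsPseudoNorm w N) (hx : ∀ k, VanishesToOrder Y w (w k) fun y => y k) {m : ℕ}
    {f : Euc n → ℝ} (hf : ContDiffAt ℝ ∞ f 0) :
    VanishesToOrder Y w m f ↔ f =O[𝓝 0] fun x => N x ^ m := by
  obtain ⟨p, -, hR⟩ := hY.isAdaptedFrame_one.exists_polyFun (fun _ => le_rfl) hf m
  have hp : ContDiffAt ℝ ∞ (polyFun p) 0 := (contDiff_polyFun p).contDiffAt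
  have hRN : (fun y => f y - polyFun p y) =O[𝓝 0] fun x => N x ^ m :=
    (hY.isBigO_norm_pow m (hf.sub hp) hR).trans ((hN.isBigO_norm hw).pow m)
  have hRw := hR.of_one_weight hw
  calc VanishesToOrder Y w m f ↔ VanishesToOrder Y w m (polyFun p) :=
        ⟨fun h => by simpa using h.sub hY.smooth hf (hf.sub hp) hRw,
          fun h => by simpa using hRw.add hY.smooth (hf.sub hp) hp h⟩
    _ ↔ polyFun p =O[𝓝 0] fun x => N x ^ m := by
        rw [hY.vanishesToOrder_polyFun_iff hx, hN.isBigO_polyFun_iff hw]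
    _ ↔ f =O[𝓝 0] fun x => N x ^ m :=
        ⟨fun h => by simpa using hRN.add h, fun h => by simpa using h.sub hRN⟩

theorem IsAdaptedFrame.exists_homogeneous_approx (hY : IsAdaptedFrame w Y) (hw : ∀ i, 1 ≤ w i)
    (hN : IsPseudoNorm w N) (hx : ∀ k, VanishesToOrder Y w (w k) fun y => y k) {m : ℕ}
    {f : Euc n → ℝ} (hf : ContDiffAt ℝ ∞ f 0) (h : VanishesToOrder Y w m f) :
    ∃ p : MvPolynomial (Fin n) ℝ, (∀ α ∈ p.support, multiWeight w α = m) ∧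
      ((fun x => f x - polyFun p x) =O[𝓝 0] fun x => N x ^ (m + 1)) ∧
      ∀ j, w j = m → p.coeff (Finsupp.single j 1) = vDeriv (Y j) f 0 := by
  obtain ⟨p, hp, hR⟩ := hY.exists_polyFun hw hf (m + 1)
  have hRs := hf.sub (contDiff_polyFun p).contDiffAt
  have hpm : VanishesToOrder Y w m (polyFun p) := by
    simpa using h.sub hY.smooth hf hRs fun I hI => hR I (Nat.lt_succ_of_lt hI)
  refine ⟨p, fun α hα => ?_, (hY.vanishesToOrder_iff_isBigO hw hN hx hRs).1 hR,
    fun j hj => hY.coeff_single_eq_vDeriv hf hR (hj ▸ Nat.lt_succ_self _)⟩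
  exact le_antisymm (Nat.le_of_lt_succ (hp α hα)) ((hY.vanishesToOrder_polyFun_iff hx).1 hpm α hα)

end Privileged

/-! ### Polynomial diffeomorphisms -/

section Triangular

variable {n : ℕ} {w : Fin n → ℕ} {P : Euc n → Euc n}

theorem iterate_sub_apply_eq (hP : ∀ k x y, (∀ i, w i < w k → x i = y i) → P x k = P y k)
    (y : Euc n) {m : ℕ} {k : Fin n} (hk : w k < m) (z z' : Euc n) :
    (fun x => y - P x)^[m] z k = (fun x => y - P x)^[m] z' k := by
  induction m generalizing k with
  | zero => exact absurd hk (Nat.not_lt_zero _)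
  | succ m ih =>
    simp only [Function.iterate_succ_apply', PiLp.sub_apply]
    rw [hP k _ _ fun i hi => ih (by omega)]

theorem contDiff_iterate_sub (hP : ContDiff ℝ ∞ P) (m : ℕ) :
    ContDiff ℝ ∞ fun y => (fun x => y - P x)^[m] y := by
  induction m with
  | zero => exact contDiff_id
  | succ m ih =>
    simp only [Function.iterate_succ_apply']
    exact contDiff_id.sub (hP.comp ih)

/-- The inverse at `y` is the fixed point of `z ↦ y - P z`. Every iteration of this map makes the
coordinates of the next weight independent of the starting point. -/
theorem exists_diffeomorph_id_add (hP : ContDiff ℝ ∞ P)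
    (hPw : ∀ k x y, (∀ i, w i < w k → x i = y i) → P x k = P y k) :
    ∃ Φ : Diffeomorph 𝓘(ℝ, Euc n) 𝓘(ℝ, Euc n) (Euc n) (Euc n) ∞, ⇑Φ = fun x => x + P x := by
  let m := Finset.univ.sup w + 1
  have iterate_eq (y z z' : Euc n) : (fun x => y - P x)^[m] z = (fun x => y - P x)^[m] z' := by
    ext k
    exact iterate_sub_apply_eq hPw y
      (Nat.lt_succ_of_le (Finset.le_sup (f := w) (Finset.mem_univ k))) z z'
  exact ⟨{
    toFun := fun x => x + P x
    invFun := fun y => (fun x => y - P x)^[m] y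
    left_inv := fun x => (iterate_eq _ _ x).trans
      (Function.IsFixedPt.iterate (f := fun z => x + P x - P z) (add_sub_cancel_right x (P x)) m)
    right_inv := fun y => by
      have isFixedPt := (Function.iterate_succ_apply' (fun x => y - P x) m y).symm.trans
        (iterate_eq y (y - P y) y)
      exact (eq_sub_iff_add_eq.1 isFixedPt.symm)
    contMDiff_toFun := (contDiff_id.add hP).contMDiff
    contMDiff_invFun := (contDiff_iterate_sub hP m).contMDiff }, rfl⟩

end Triangular

section PolynomialMaps

open MvPolynomial

variable {n : ℕ} {w : Fin n → ℕ}

/-- The polynomial map of `ℝⁿ` with the components `q k`. -/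
noncomputable def polyMap (q : Fin n → MvPolynomial (Fin n) ℝ) (x : Euc n) : Euc n :=
  WithLp.toLp 2 fun k => polyFun (q k) x

theorem contDiff_polyMap (q : Fin n → MvPolynomial (Fin n) ℝ) : ContDiff ℝ ∞ (polyMap q) :=
  contDiff_euclidean.2 fun k => contDiff_polyFun (q k)

theorem fderiv_polyFun_zero (p : MvPolynomial (Fin n) ℝ) (j : Fin n) :
    fderiv ℝ (polyFun p) 0 (EuclideanSpace.single j (1 : ℝ)) = p.coeff (Finsupp.single j 1) :=
  have hconst : IsStandardFrame fun (j : Fin n) (_ : Euc n) => EuclideanSpace.single j (1 : ℝ) :=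
    ⟨fun _ => contDiffAt_const, fun _ => rfl⟩
  (hconst.coeff_single_eq_vDeriv_polyFun p j).symm

theorem hasFDerivAt_polyMap_zero {q : Fin n → MvPolynomial (Fin n) ℝ}
    (hq : ∀ j k, (q k).coeff (Finsupp.single j 1) = (X k : MvPolynomial (Fin n) ℝ).coeff
      (Finsupp.single j 1)) :
    HasFDerivAt (polyMap q) (ContinuousLinearMap.id ℝ (Euc n)) 0 := by
  rw [← hasFDerivWithinAt_univ, hasFDerivWithinAt_euclidean]
  intro k
  rw [hasFDerivWithinAt_univ]
  refine ((contDiff_polyFun (q k)).differentiable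
    (by simp)).differentiableAt.hasFDerivAt.congr_fderiv (clm_ext_single fun j => ?_)
  rw [fderiv_polyFun_zero, hq, coeff_X]
  simp [Finsupp.single_left_inj]

theorem le_multiWeight {α : Fin n →₀ ℕ} {i : Fin n} (hi : α i ≠ 0) : w i ≤ multiWeight w α :=
  (Nat.le_mul_of_pos_right _ (Nat.pos_of_ne_zero hi)).trans
    (Finset.single_le_sum (f := fun i => w i * α i) (fun _ _ => Nat.zero_le _) (Finset.mem_univ i))

theorem eq_single_of_multiWeight_le (hw : ∀ i, 1 ≤ w i) {α : Fin n →₀ ℕ} {i : Fin n}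
    (hi : α i ≠ 0) (h : multiWeight w α ≤ w i) : α = Finsupp.single i 1 := by
  obtain ⟨β, rfl⟩ := exists_add_of_le
    (Finsupp.single_le_iff.2 (Nat.one_le_iff_ne_zero.2 hi))
  rw [multiWeight_add, multiWeight_single, one_mul] at h
  have hβ : β = 0 := by
    ext j
    by_contra hj
    have := (hw j).trans (le_multiWeight (w := w) hj)
    omega
  rw [hβ, add_zero]

theorem exists_diffeomorph_polyMap {q : Fin n → MvPolynomial (Fin n) ℝ}
    (hq : ∀ k, ∀ α ∈ (q k - X k).support, ∀ i, α i ≠ 0 → w i < w k) :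
    ∃ Φ : Diffeomorph 𝓘(ℝ, Euc n) 𝓘(ℝ, Euc n) (Euc n) (Euc n) ∞, ⇑Φ = polyMap q := by
  obtain ⟨Φ, hΦ⟩ := exists_diffeomorph_id_add (w := w) (contDiff_polyMap fun k => q k - X k)
    fun k x y hxy => by
      simp only [polyMap, polyFun]
      refine eval₂Hom_congr' rfl (fun i hi _ => ?_) rfl
      obtain ⟨α, hα, hiα⟩ := mem_vars_iff_mem_support i |>.1 hi
      exact hxy i (hq k α hα i (Finsupp.mem_support_iff.1 hiα))
  refine ⟨Φ, hΦ.trans (funext fun x => ?_)⟩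
  ext k
  simp [polyMap, polyFun]

theorem exists_diffeomorph_homogeneous (hw : ∀ i, 1 ≤ w i) {q : Fin n → MvPolynomial (Fin n) ℝ}
    (hq : ∀ k, ∀ α ∈ (q k).support, multiWeight w α = w k)
    (hq1 : ∀ j k, w j = w k → (q k).coeff (Finsupp.single j 1) = if j = k then 1 else 0) :
    ∃ Φ : Diffeomorph 𝓘(ℝ, Euc n) 𝓘(ℝ, Euc n) (Euc n) (Euc n) ∞, ⇑Φ = polyMap q ∧
      IsPolynomialMap Φ ∧ IsWHomogeneous w Φ ∧
      HasFDerivAt Φ (ContinuousLinearMap.id ℝ (Euc n)) 0 := by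
  have coeff_single : ∀ j k, (q k).coeff (Finsupp.single j 1) =
      (X k : MvPolynomial (Fin n) ℝ).coeff (Finsupp.single j 1) := by
    intro j k
    simp only [coeff_X, Finsupp.single_left_inj one_ne_zero, eq_comm (a := k)]
    by_cases hjk : w j = w k
    · exact hq1 j k hjk
    · rw [if_neg (ne_of_apply_ne w hjk), ← notMem_support_iff]
      exact fun hj => hjk (by simpa [multiWeight_single] using hq k _ hj)
  obtain ⟨Φ, hΦ⟩ := exists_diffeomorph_polyMap (w := w) (q := q) fun k α hα i hi => by
    by_contra! hik
    have hαw : multiWeight w α = w k := by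
      rcases Finset.mem_union.1 (support_sub _ _ _ hα) with h | h
      · exact hq k α h
      · rw [support_X, Finset.mem_singleton] at h
        rw [h, multiWeight_single, one_mul]
    rw [eq_single_of_multiWeight_le hw hi (hαw.trans_le hik), mem_support_iff, coeff_sub,
      coeff_single, sub_self] at hα
    exact hα rfl
  refine ⟨Φ, hΦ, ⟨q, fun x k => by rw [hΦ]; rfl⟩, fun t x => ?_,
    hΦ ▸ hasFDerivAt_polyMap_zero coeff_single⟩
  rw [hΦ]
  ext k
  exact polyFun_dilation (hq k) t x

theorem isTriangularPoly_iff {f : Euc n → Euc n} :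
    IsTriangularPoly w f ↔ ∃ q : Fin n → MvPolynomial (Fin n) ℝ,
      (∀ k, ∀ α ∈ (q k - X k).support, multiWeight w α < w k ∧ 2 ≤ multiLength α) ∧
        f = polyMap q := by
  refine ⟨fun ⟨P, hP, hf⟩ => ⟨fun k => X k + P k, by simpa using hP, ?_⟩,
    fun ⟨q, hq, hf⟩ => ⟨fun k => q k - X k, hq, fun x k => ?_⟩⟩
  · ext x k
    simp [polyMap, polyFun, hf]
  · simp [polyMap, polyFun, hf]

namespace IsTriangularPoly

variable {f : Euc n → Euc n}

theorem exists_diffeomorph (hf : IsTriangularPoly w f) :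
    ∃ Φ : Diffeomorph 𝓘(ℝ, Euc n) 𝓘(ℝ, Euc n) (Euc n) (Euc n) ∞, ⇑Φ = f := by
  obtain ⟨q, hq, rfl⟩ := isTriangularPoly_iff.1 hf
  exact exists_diffeomorph_polyMap fun k α hα i hi => (le_multiWeight hi).trans_lt (hq k α hα).1

theorem map_zero (hf : IsTriangularPoly w f) : f 0 = 0 := by
  obtain ⟨P, hP, hPf⟩ := hf
  ext k
  have hP0 : (P k).coeff 0 = 0 :=
    notMem_support_iff.1 fun h => by simpa [multiLength] using (hP k 0 h).2
  simpa [hPf, constantCoeff_eq] using hP0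

theorem hasFDerivAt_zero (hf : IsTriangularPoly w f) :
    HasFDerivAt f (ContinuousLinearMap.id ℝ (Euc n)) 0 := by
  obtain ⟨q, hq, rfl⟩ := isTriangularPoly_iff.1 hf
  refine hasFDerivAt_polyMap_zero fun j k => sub_eq_zero.1 ?_
  rw [← coeff_sub, ← notMem_support_iff]
  intro hj
  simpa [← multiWeight_one, multiWeight_single] using (hq k _ hj).2

end IsTriangularPoly

end PolynomialMaps

/-! ### Privileged coordinates in `ℝⁿ` -/

section PrivilegedChange

open MvPolynomial

variable {n : ℕ} {w : Fin n → ℕ} {Y : Fin n → Euc n → Euc n}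

theorem IsTriangularPoly.contDiff {f : Euc n → Euc n} (hf : IsTriangularPoly w f) :
    ContDiff ℝ ∞ f := by
  obtain ⟨Φ, rfl⟩ := hf.exists_diffeomorph
  exact Φ.contMDiff.contDiff

/-- The linear coefficient `p_j` of a remainder of weight `< w_k` is `Y_j x_k (0) = 0` because
`w_j < w_k`. -/
theorem IsStandardFrame.two_le_multiLength (hY : IsStandardFrame Y) (hw : ∀ i, 1 ≤ w i)
    {k : Fin n} {p : MvPolynomial (Fin n) ℝ} (hp : ∀ α ∈ p.support, multiWeight w α < w k)
    (h : VanishesToOrder Y w (w k) fun y => y k - polyFun p y) {α : Fin n →₀ ℕ}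
    (hα : α ∈ p.support) : 2 ≤ multiLength α := by
  have coeff_zero : p.coeff 0 = 0 := by
    simpa [polyFun, iterVDeriv, constantCoeff_eq] using h [] (hw k)
  by_contra! hlt
  rcases eq_or_ne α 0 with rfl | hα0
  · exact mem_support_iff.1 hα coeff_zero
  obtain ⟨j, hj⟩ := Finsupp.ne_iff.1 hα0
  obtain rfl := eq_single_of_multiWeight_le (w := fun _ => 1) (fun _ => le_rfl) hj
    (by rw [multiWeight_one]; omega)
  have hjk : w j < w k := by simpa [multiWeight_single] using hp _ hα
  refine mem_support_iff.1 hα ?_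
  rw [hY.coeff_single_eq_vDeriv (contDiffAt_coord k 0) h hjk, vDeriv, fderiv_coord, hY.eq_single]
  simp [ne_of_apply_ne w hjk.ne']

theorem IsAdaptedFrame.exists_triangular (hY : IsAdaptedFrame w Y) (hw : ∀ i, 1 ≤ w i) :
    ∃ f, IsTriangularPoly w f ∧ ∀ k, VanishesToOrder Y w (w k) fun y => f y k := by
  choose p hp h using fun k => hY.exists_polyFun hw (contDiffAt_coord k 0) (w k)
  refine ⟨polyMap fun k => X k - p k, isTriangularPoly_iff.2 ⟨_, fun k α hα => ?_, rfl⟩,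
    fun k => ?_⟩
  · rw [sub_sub_cancel_left, support_neg] at hα
    exact ⟨hp k α hα, hY.two_le_multiLength hw (hp k) (h k) hα⟩
  · simpa [polyMap, polyFun] using h k

theorem IsStandardFrame.triangular_unique (hY : IsStandardFrame Y) {f g : Euc n → Euc n}
    (hf : IsTriangularPoly w f) (hg : IsTriangularPoly w g)
    (hfY : ∀ k, VanishesToOrder Y w (w k) fun y => f y k)
    (hgY : ∀ k, VanishesToOrder Y w (w k) fun y => g y k) : f = g := by
  obtain ⟨p, hp, rfl⟩ := isTriangularPoly_iff.1 hf
  obtain ⟨q, hq, rfl⟩ := isTriangularPoly_iff.1 hg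
  have hpq : ∀ k, p k - q k = 0 := fun k => by
    refine hY.eq_zero_of_vanishesToOrder (w := w) (N := w k) (fun α hα => ?_) ?_
    · rw [← sub_sub_sub_cancel_right _ _ (X k)] at hα
      exact (Finset.mem_union.1 (support_sub _ _ _ hα)).elim (fun h => (hp k α h).1)
        fun h => (hq k α h).1
    · have polyFun_sub : polyFun (p k - q k) = fun y => polyFun (p k) y - polyFun (q k) y :=
        funext fun y => map_sub _ _ _
      rw [polyFun_sub]
      exact (hfY k).sub hY.smooth (contDiff_polyFun _).contDiffAt
        (contDiff_polyFun _).contDiffAt (hgY k)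
  exact congrArg polyMap (funext fun k => sub_eq_zero.1 (hpq k))

theorem IsAdaptedFrame.existsUnique_triangular (hY : IsAdaptedFrame w Y) (hw : ∀ i, 1 ≤ w i) :
    ∃! f, IsTriangularPoly w f ∧ ∀ k, VanishesToOrder Y w (w k) fun y => f y k :=
  existsUnique_of_exists_of_unique (hY.exists_triangular hw) fun _ _ hf hg =>
    hY.triangular_unique hf.1 hg.1 hf.2 hg.2

theorem vDeriv_coord {Z F : Euc n → Euc n} {x : Euc n}
    (hF : HasFDerivAt F (ContinuousLinearMap.id ℝ (Euc n)) x) (k : Fin n) :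
    vDeriv Z (fun y => F y k) x = Z x k :=
  congrArg (fun L => L (Z x))
    ((EuclideanSpace.proj k : Euc n →L[ℝ] ℝ).hasFDerivAt.comp x hF).fderiv

theorem IsAdmissibleChange.isBigO_coord {N : Euc n → ℝ}
    {φ : OpenPartialHomeomorph (Euc n) (Euc n)} (hφ : IsAdmissibleChange w N φ)
    (hN : IsPseudoNorm w N) (hw : ∀ i, 1 ≤ w i) (k : Fin n) :
    (fun x => φ x k) =O[𝓝 0] fun x => N x ^ w k := by
  obtain ⟨φ', -, hom, -, remainder⟩ := hφ.expansion
  have leading : (fun x => φ' x k) =O[𝓝 0] fun x => N x ^ w k :=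
    hN.isBigO_of_homogeneous hw
      ((EuclideanSpace.proj k : Euc n →L[ℝ] ℝ).continuous.comp φ'.continuous)
      fun t x => congrArg (fun v : Euc n => v k) (hom t x)
  simpa using ((remainder k).trans (hN.isBigO_pow (Nat.le_succ _))).add leading

theorem IsAdaptedFrame.isAdmissibleChange_iff (hY : IsAdaptedFrame w Y) (hw : ∀ i, 1 ≤ w i)
    {N : Euc n → ℝ} (hN : IsPseudoNorm w N) (hx : ∀ k, VanishesToOrder Y w (w k) fun y => y k)
    {φ : OpenPartialHomeomorph (Euc n) (Euc n)} (h0 : 0 ∈ φ.source)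
    (hφ : ContDiffOn ℝ ∞ φ φ.source) (hφsymm : ContDiffOn ℝ ∞ φ.symm φ.target) :
    IsAdmissibleChange w N φ ↔ HasFDerivAt φ (ContinuousLinearMap.id ℝ (Euc n)) 0 ∧
      ∀ k, VanishesToOrder Y w (w k) fun y => φ y k := by
  have smooth_coord : ∀ k, ContDiffAt ℝ ∞ (fun y => φ y k) 0 := fun k =>
    (contDiffAt_coord k _).comp 0 (hφ.contDiffAt (φ.open_source.mem_nhds h0))
  refine ⟨fun h => ⟨h.hasFDerivAt, fun k => ?_⟩, fun ⟨hφ1, hφv⟩ => ?_⟩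
  · exact (hY.vanishesToOrder_iff_isBigO hw hN hx (smooth_coord k)).2 (h.isBigO_coord hN hw k)
  · choose q hq hqO hq1 using fun k =>
      hY.exists_homogeneous_approx hw hN hx (smooth_coord k) (hφv k)
    obtain ⟨φ', coe_φ', poly, hom, hφ'1⟩ := exists_diffeomorph_homogeneous hw hq fun j k hjk => by
      rw [hq1 k j hjk, vDeriv_coord hφ1, hY.eq_single]
      simp [eq_comm]
    exact ⟨h0, hφ, hφsymm, hφ1, φ', poly, hom, hφ'1, fun k => by rw [coe_φ']; exact hqO k⟩

end PrivilegedChange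

/-! ### Weighted frames on manifolds -/

section WeightedFrames

open VectorField

variable {n r : ℕ} {M : Type*} [TopologicalSpace M] [ChartedSpace (Euc n) M]

instance finiteDimensional_tangentSpace (x : M) : FiniteDimensional ℝ (TangentSpace (𝓡 n) x) :=
  inferInstanceAs (FiniteDimensional ℝ (Euc n))

theorem finrank_tangentSpace (x : M) : Module.finrank ℝ (TangentSpace (𝓡 n) x) = n :=
  finrank_euclideanSpace_fin (𝕜 := ℝ) (n := n)

variable [IsManifold (𝓡 n) ∞ M] {H : CarnotFiltration n r M} {X : Fin n → VField n M} {U : Set M}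

/-- A smooth tangent frame over `U` with positive weights `w` that is compatible with Lie brackets:
`[X_i, X_j]` is a combination of the `X_k` with `w_k ≤ w_i + w_j`. This is the only trace of the
filtration that matters for privileged coordinates. -/
structure IsWeightedFrameOn (w : Fin n → ℕ) (X : Fin n → VField n M) (U : Set M) : Prop where
  one_le_weight : ∀ k, 1 ≤ w k
  smooth : ∀ j, SmoothVFieldOn (X j) U
  linearIndependent : ∀ x ∈ U, LinearIndependent ℝ fun j => X j x
  bracket : ∀ i j, ∀ x ∈ U, mlieBracket (𝓡 n) (X i) (X j) x ∈
    Submodule.span ℝ ((fun k => X k x) '' {k | w k ≤ w i + w j})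

namespace CarnotFiltration

theorem finrank_eq (H : CarnotFiltration n r M) {w : ℕ} (h1 : 1 ≤ w) (hr : w ≤ r) (x : M) :
    Module.finrank ℝ (H.H w x) = H.rk w := by
  obtain ⟨U, -, hx, Y, -, hY⟩ := H.subbundle w h1 hr x
  rw [← (hY x hx).2, finrank_span_eq_card (hY x hx).1, Fintype.card_fin]

theorem rk_le (H : CarnotFiltration n r M) {w : ℕ} (h1 : 1 ≤ w) (hr : w ≤ r) (x : M) :
    H.rk w ≤ n := by
  rw [← H.finrank_eq h1 hr x]
  exact (Submodule.finrank_le _).trans (finrank_tangentSpace x).le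

theorem rk_step (H : CarnotFiltration n r M) (x : M) : H.rk r = n := by
  rw [← H.finrank_eq H.one_le_step le_rfl x, H.top, finrank_top, finrank_tangentSpace]

theorem weight_spec (H : CarnotFiltration n r M) (x : M) (j : Fin n) :
    1 ≤ H.weight j ∧ H.weight j ≤ r ∧ (j : ℕ) + 1 ≤ H.rk (H.weight j) :=
  Nat.sInf_mem (s := {w : ℕ | 1 ≤ w ∧ w ≤ r ∧ (j : ℕ) + 1 ≤ H.rk w})
    ⟨r, H.one_le_step, le_rfl, by rw [H.rk_step x]; exact j.2⟩

end CarnotFiltration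

namespace IsHFrameOn

theorem span_image_weight_le (hX : IsHFrameOn H X U) {x : M} (hx : x ∈ U) {w : ℕ} (h1 : 1 ≤ w)
    (hr : w ≤ r) :
    Submodule.span ℝ ((fun k => X k x) '' {k | H.weight k ≤ w}) = H.H w x := by
  refine Submodule.eq_of_le_of_finrank_le (Submodule.span_le.2 ?_) ?_
  · rintro _ ⟨k, hk, rfl⟩
    exact H.mono _ _ (H.weight_spec x k).1 hk hr x (hX.mem k x hx)
  · let ι := Fin.castLE (H.rk_le h1 hr x)
    calc Module.finrank ℝ (H.H w x)
        = Module.finrank ℝ (Submodule.span ℝ (Set.range fun k => X (ι k) x)) := by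
          rw [H.finrank_eq h1 hr, finrank_span_eq_card (b := fun k => X (ι k) x)
            ((hX.linearIndependent x hx).comp ι (Fin.castLE_injective _)), Fintype.card_fin]
      _ ≤ _ := Submodule.finrank_mono <| Submodule.span_mono <| by
          rintro _ ⟨k, rfl⟩
          exact ⟨ι k, Nat.sInf_le ⟨h1, hr, k.2⟩, rfl⟩

theorem isWeightedFrameOn (hX : IsHFrameOn H X U) (hU : IsOpen U) (x₀ : M) :
    IsWeightedFrameOn H.weight X U where
  one_le_weight k := (H.weight_spec x₀ k).1
  smooth := hX.smooth
  linearIndependent := hX.linearIndependent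
  bracket i j x hx := by
    have hi := H.weight_spec x₀ i
    have hj := H.weight_spec x₀ j
    rcases le_or_gt (H.weight i + H.weight j) r with hr | hr
    · rw [hX.span_image_weight_le hx (by omega) hr]
      exact H.bracket _ _ hi.1 hj.1 hr U hU _ _ (hX.smooth i) (hX.smooth j) (hX.mem i) (hX.mem j)
        x hx
    · have all_weights : {k | H.weight k ≤ H.weight i + H.weight j} = Set.univ :=
        Set.eq_univ_of_forall fun k => (H.weight_spec x₀ k).2.1.trans hr.le
      rw [all_weights, Set.image_univ, hX.span_eq_top x hx]
      exact Submodule.mem_top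

end IsHFrameOn

end WeightedFrames

/-! ### Vector fields in a chart -/

section Charts

open VectorField

variable {n : ℕ} {M : Type*} [TopologicalSpace M] [ChartedSpace (Euc n) M]
  {a : M} {θ : OpenPartialHomeomorph M (Euc n)}

/-- The vector fields `X` in the coordinates `θ`, as vector fields on `ℝⁿ`. -/
noncomputable def pushFrame (θ : OpenPartialHomeomorph M (Euc n)) (X : Fin n → VField n M)
    (j : Fin n) : Euc n → Euc n :=
  mpullback 𝓘(ℝ, Euc n) (𝓡 n) θ.symm (X j)

namespace IsCenteredChart

theorem zero_mem_target (hθ : IsCenteredChart a θ) : (0 : Euc n) ∈ θ.target :=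
  hθ.map_zero ▸ θ.map_source hθ.mem_source

theorem symm_zero (hθ : IsCenteredChart a θ) : θ.symm 0 = a :=
  hθ.map_zero ▸ θ.left_inv hθ.mem_source

theorem tendsto_nhds (hθ : IsCenteredChart a θ) : Filter.Tendsto θ (𝓝 a) (𝓝 0) :=
  hθ.map_zero ▸ θ.continuousAt hθ.mem_source

variable {X : Fin n → VField n M}

theorem mdifferentiable (hθ : IsCenteredChart a θ) : θ.MDifferentiable (𝓡 n) 𝓘(ℝ, Euc n) :=
  ⟨(contMDiffOn_of_mem_maximalAtlas hθ.mem_maximalAtlas).mdifferentiableOn (by simp),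
    (contMDiffOn_symm_of_mem_maximalAtlas hθ.mem_maximalAtlas).mdifferentiableOn (by simp)⟩

theorem isInvertible_mfderiv_symm (hθ : IsCenteredChart a θ) {y : Euc n} (hy : y ∈ θ.target) :
    (mfderiv 𝓘(ℝ, Euc n) (𝓡 n) θ.symm y).IsInvertible :=
  ⟨hθ.mdifferentiable.symm.mfderiv hy, rfl⟩

theorem contMDiffAt_symm (hθ : IsCenteredChart a θ) {y : Euc n} (hy : y ∈ θ.target) :
    ContMDiffAt 𝓘(ℝ, Euc n) (𝓡 n) ∞ θ.symm y :=
  (contMDiffOn_symm_of_mem_maximalAtlas hθ.mem_maximalAtlas).contMDiffAt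
    (θ.open_target.mem_nhds hy)

theorem pushFrame_apply (hθ : IsCenteredChart a θ) (X : Fin n → VField n M) (j : Fin n) {p : M}
    (hp : p ∈ θ.source) :
    pushFrame θ X j (θ p) = mfderiv (𝓡 n) 𝓘(ℝ, Euc n) θ p (X j p) := by
  have symm_comp : ∀ q, q = p → mfderiv 𝓘(ℝ, Euc n) (𝓡 n) θ.symm (θ p)
      (mfderiv (𝓡 n) 𝓘(ℝ, Euc n) θ p (X j p)) = X j q := by
    rintro _ rfl
    exact congrArg (fun L => L (X j _)) (hθ.mdifferentiable.symm_comp_deriv hp)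
  exact (hθ.isInvertible_mfderiv_symm (θ.map_source hp)).inverse_apply_eq.2
    (symm_comp _ (θ.left_inv hp)).symm

theorem mfderiv_apply_eq (hθ : IsCenteredChart a θ) {E : Type*} [NormedAddCommGroup E]
    [NormedSpace ℝ E] {F : Euc n → E} (hF : DifferentiableAt ℝ F 0) {h : M → E}
    (hFh : h =ᶠ[𝓝 a] F ∘ θ) (v : TangentSpace (𝓡 n) a) :
    mfderiv (𝓡 n) 𝓘(ℝ, E) h a v = fderiv ℝ F 0 (mfderiv (𝓡 n) 𝓘(ℝ, Euc n) θ a v) := by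
  rw [hFh.mfderiv_eq, ← mfderiv_eq_fderiv]
  exact mfderiv_comp_apply_of_eq (g := F) (f := θ) a hF.mdifferentiableAt
    (hθ.mdifferentiable.mdifferentiableAt hθ.mem_source) hθ.map_zero v

theorem lieDeriv_eventuallyEq (hθ : IsCenteredChart a θ) (X : Fin n → VField n M) (j : Fin n)
    {g : Euc n → ℝ} (hg : ContDiffAt ℝ ∞ g 0) {h : M → ℝ} (hgh : h =ᶠ[𝓝 a] g ∘ θ) :
    lieDeriv (X j) h =ᶠ[𝓝 a] vDeriv (pushFrame θ X j) g ∘ θ := by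
  filter_upwards [hgh.eventuallyEq_nhds, θ.open_source.mem_nhds hθ.mem_source,
    hθ.tendsto_nhds.eventually (eventually_differentiableAt hg)] with p hghp hp hgp
  rw [lieDeriv, hghp.mfderiv_eq, Function.comp_apply, vDeriv, hθ.pushFrame_apply X j hp,
    ← mfderiv_eq_fderiv]
  exact mfderiv_comp_apply p hgp.mdifferentiableAt (hθ.mdifferentiable.mdifferentiableAt hp) (X j p)

theorem iterDeriv_eventuallyEq (hθ : IsCenteredChart a θ)
    (hX : ∀ j, ContDiffAt ℝ ∞ (pushFrame θ X j) 0) {g : Euc n → ℝ} (hg : ContDiffAt ℝ ∞ g 0)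
    {h : M → ℝ} (hgh : h =ᶠ[𝓝 a] g ∘ θ) (I : List (Fin n)) :
    iterDeriv X I h =ᶠ[𝓝 a] iterVDeriv (pushFrame θ X) I g ∘ θ := by
  induction I with
  | nil => exact hgh
  | cons i I ih => exact hθ.lieDeriv_eventuallyEq X i (contDiffAt_iterVDeriv hX hg I) ih

variable [IsManifold (𝓡 n) ∞ M] {U : Set M}

theorem transDiffeomorph (hθ : IsCenteredChart a θ)
    (Φ : Diffeomorph 𝓘(ℝ, Euc n) 𝓘(ℝ, Euc n) (Euc n) (Euc n) ∞) (hΦ : Φ 0 = 0) :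
    IsCenteredChart a (θ.transHomeomorph Φ.toHomeomorph) where
  mem_maximalAtlas := OpenPartialHomeomorph.mem_maximalAtlas_of_contMDiffOn _
    (Φ.contMDiff.comp_contMDiffOn (contMDiffOn_of_mem_maximalAtlas hθ.mem_maximalAtlas))
    ((contMDiffOn_symm_of_mem_maximalAtlas hθ.mem_maximalAtlas).comp
      Φ.symm.contMDiff.contMDiffOn fun _ h => h)
  mem_source := hθ.mem_source
  map_zero := (congrArg Φ hθ.map_zero).trans hΦ

theorem contDiffAt_pushFrame (hθ : IsCenteredChart a θ) (hU : U ∈ 𝓝 a)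
    (hX : ∀ j, SmoothVFieldOn (X j) U) (j : Fin n) : ContDiffAt ℝ ∞ (pushFrame θ X j) 0 := by
  refine contMDiffAt_vectorSpace_iff_contDiffAt.1 (ContMDiffAt.mpullback_vectorField_preimage
    (n := ∞) ?_ (hθ.contMDiffAt_symm hθ.zero_mem_target)
    (hθ.isInvertible_mfderiv_symm hθ.zero_mem_target) (by simp))
  rw [hθ.symm_zero]
  exact (hX j).contMDiffAt hU

theorem lieBracket_pushFrame (hθ : IsCenteredChart a θ) (hU : IsOpen U)
    (hX : ∀ j, SmoothVFieldOn (X j) U) (i j : Fin n) {y : Euc n} (hy : y ∈ θ.target)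
    (hyU : θ.symm y ∈ U) :
    lieBracket ℝ (pushFrame θ X i) (pushFrame θ X j) y =
      mpullback 𝓘(ℝ, Euc n) (𝓡 n) θ.symm (mlieBracket (𝓡 n) (X i) (X j)) y := by
  have two_le : minSmoothness ℝ 2 ≤ ∞ := by
    rw [minSmoothness_of_isRCLikeNormedField]
    exact WithTop.coe_le_coe.2 le_top
  have : IsManifold (𝓡 n) (minSmoothness ℝ 2) M := IsManifold.of_le two_le
  have mdifferentiableAt : ∀ j, MDifferentiableAt (𝓡 n) (𝓡 n).tangent
      (fun x => (⟨x, X j x⟩ : TangentBundle (𝓡 n) M)) (θ.symm y) := fun j =>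
    ((hX j).contMDiffAt (hU.mem_nhds hyU)).mdifferentiableAt (by simp)
  rw [mpullback_mlieBracket (n := ∞) (mdifferentiableAt i) (mdifferentiableAt j)
    (hθ.contMDiffAt_symm hy) two_le, ← mlieBracketWithin_univ,
    mlieBracketWithin_eq_lieBracketWithin, ← lieBracketWithin_univ]
  rfl

theorem isAdaptedFrame_pushFrame (hθ : IsCenteredChart a θ) {w : Fin n → ℕ}
    (hX : IsWeightedFrameOn w X U) (hU : IsOpen U) (haU : a ∈ U) (hθX : LinearlyAdapted X a θ) :
    IsAdaptedFrame w (pushFrame θ X) where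
  smooth := hθ.contDiffAt_pushFrame (hU.mem_nhds haU) hX.smooth
  eq_single j := by rw [← hθX.2 j, ← hθ.pushFrame_apply X j hθ.mem_source, hθ.map_zero]
  bracket i j := by
    have symm_mem : ∀ᶠ y in 𝓝 (0 : Euc n), θ.symm y ∈ U :=
      (θ.continuousAt_symm hθ.zero_mem_target).eventually
        (by rw [hθ.symm_zero]; exact hU.mem_nhds haU)
    filter_upwards [θ.open_target.mem_nhds hθ.zero_mem_target, symm_mem] with y hy hyU
    rw [hθ.lieBracket_pushFrame hU hX.smooth i j hy hyU]
    let L := (mfderiv 𝓘(ℝ, Euc n) (𝓡 n) θ.symm y).inverse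
    have mem_map := Submodule.mem_map_of_mem (f := L.toLinearMap) (hX.bracket i j _ hyU)
    rwa [Submodule.map_span, Set.image_image] at mem_map

end IsCenteredChart

end Charts

/-! ### Privileged coordinates on a manifold -/

section PrivilegedCoordinates

variable {n : ℕ} {M : Type*} [TopologicalSpace M] [ChartedSpace (Euc n) M] {a : M}
  {w : Fin n → ℕ} {X : Fin n → VField n M} {U : Set M}

theorem exists_continuousLinearEquiv_apply_eq_single {v : Fin n → Euc n}
    (hv : LinearIndependent ℝ v) :
    ∃ L : Euc n ≃L[ℝ] Euc n, ∀ j, L (v j) = EuclideanSpace.single j (1 : ℝ) := by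
  let b := Module.Basis.mk hv (hv.span_eq_top_of_card_eq_finrank' (by simp)).ge
  refine ⟨(b.equiv (EuclideanSpace.basisFun (Fin n) ℝ).toBasis
    (Equiv.refl _)).toContinuousLinearEquiv, fun j => ?_⟩
  have hb : v j = b j := (Module.Basis.mk_apply hv _ j).symm
  simp [hb]

theorem linearlyAdapted_iff {h : M → Euc n} {θ : OpenPartialHomeomorph M (Euc n)}
    (hθ : IsCenteredChart a θ) (hθX : LinearlyAdapted X a θ) {F : Euc n → Euc n}
    (hF : DifferentiableAt ℝ F 0) (hFh : h =ᶠ[𝓝 a] F ∘ θ) :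
    LinearlyAdapted X a h ↔
      F 0 = 0 ∧ HasFDerivAt F (ContinuousLinearMap.id ℝ (Euc n)) 0 := by
  simp only [LinearlyAdapted, hθ.mfderiv_apply_eq hF hFh, hθX.2]
  refine and_congr (by rw [hFh.eq_of_nhds, Function.comp_apply, hθ.map_zero])
    ⟨fun h1 => ?_, fun h1 j => ?_⟩
  · exact hF.hasFDerivAt.congr_fderiv (clm_ext_single h1)
  · rw [h1.fderiv]
    rfl

theorem exists_linearlyAdapted (hX : LinearIndependent ℝ fun j => X j a)
    {κ : OpenPartialHomeomorph M (Euc n)} (hκ : IsCenteredChart a κ) :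
    ∃ L : Euc n ≃L[ℝ] Euc n, ∀ T : Euc n ≃ᵃ[ℝ] Euc n,
      LinearlyAdapted X a (fun p => T (κ p)) ↔ ⇑T = L := by
  let e := hκ.mdifferentiable.mfderiv hκ.mem_source
  have hv : LinearIndependent ℝ fun j => (e (X j a) : Euc n) :=
    hX.map' e.toLinearMap (LinearMap.ker_eq_bot.2 e.injective)
  obtain ⟨L, hL⟩ := exists_continuousLinearEquiv_apply_eq_single hv
  have hLsymm (j : Fin n) : L.symm (EuclideanSpace.single j 1) = e (X j a) :=
    L.symm_apply_eq.2 (hL j).symm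
  refine ⟨L, fun T => ?_⟩
  let T' : Euc n →ᴬ[ℝ] Euc n := (AffineEquiv.toContinuousAffineEquiv T).toContinuousAffineMap
  have decomp (x : Euc n) : T x = T'.contLinear x + T 0 := congrFun T'.decomp x
  have map_a : T (κ a) = T 0 := congrArg T hκ.map_zero
  have mfderiv_eq (v : TangentSpace (𝓡 n) a) :
      mfderiv (𝓡 n) 𝓘(ℝ, Euc n) (fun p => T (κ p)) a v = T'.contLinear (e v) :=
    (hκ.mfderiv_apply_eq (F := T) T'.differentiableAt Filter.EventuallyEq.rfl v).trans
      (congrArg (fun A => A (e v)) T'.fderiv)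
  refine ⟨fun ⟨h0, h1⟩ => funext fun x => ?_, fun h => ⟨map_a.trans (by rw [h, map_zero]),
    fun j => (mfderiv_eq _).trans ?_⟩⟩
  · have linear_eq : T'.contLinear ∘L L.symm = ContinuousLinearMap.id ℝ (Euc n) :=
      clm_ext_single fun j => (congrArg T'.contLinear (hLsymm j)).trans
        ((mfderiv_eq _).symm.trans (h1 j))
    rw [decomp, map_a.symm.trans h0, add_zero]
    simpa using congrArg (fun A => A (L x)) linear_eq
  · have linear_eq := decomp (e (X j a))
    rw [h, map_zero, add_zero, hL] at linear_eq
    exact linear_eq.symm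

variable [IsManifold (𝓡 n) ∞ M]

theorem IsWeightedFrameOn.privileged_iff (hX : IsWeightedFrameOn w X U) (hU : IsOpen U)
    (haU : a ∈ U) {θ : OpenPartialHomeomorph M (Euc n)} (hθ : IsCenteredChart a θ)
    (hθX : LinearlyAdapted X a θ) {h : M → Euc n} {F : Euc n → Euc n} (hF : ContDiffAt ℝ ∞ F 0)
    (hFh : h =ᶠ[𝓝 a] F ∘ θ) :
    Privileged X w a h ↔ HasFDerivAt F (ContinuousLinearMap.id ℝ (Euc n)) 0 ∧
      ∀ k, VanishesToOrder (pushFrame θ X) w (w k) fun y => F y k := by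
  have hY := hθ.isAdaptedFrame_pushFrame hX hU haU hθX
  have iterDeriv_eq : ∀ k I, iterDeriv X I (fun p => h p k) a =
      iterVDeriv (pushFrame θ X) I (fun y => F y k) 0 := fun k I => by
    have eventuallyEq := hθ.iterDeriv_eventuallyEq (g := fun y => F y k) (h := fun p => h p k)
      hY.smooth ((contDiffAt_coord k _).comp 0 hF) (hFh.fun_comp fun v => v k) I
    rw [eventuallyEq.eq_of_nhds, Function.comp_apply, hθ.map_zero]
  simp only [Privileged, linearlyAdapted_iff hθ hθX (hF.differentiableAt (by simp)) hFh, HasOrder,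
    iterDeriv_eq]
  refine ⟨fun ⟨⟨_, h1⟩, hv⟩ => ⟨h1, fun k => (hv k).1⟩, fun ⟨h1, hv⟩ => ⟨⟨?_, h1⟩, fun k =>
    ⟨hv k, [k], by simp [listWeight], ?_⟩⟩⟩
  · ext k
    exact hv k [] (hX.one_le_weight k)
  · change vDeriv (pushFrame θ X k) (fun y => F y k) 0 ≠ 0
    rw [vDeriv_coord h1, hY.eq_single]
    simp

theorem IsWeightedFrameOn.existsUnique_isPsiMap (hX : IsWeightedFrameOn w X U) (hU : IsOpen U)
    (haU : a ∈ U) {κ : OpenPartialHomeomorph M (Euc n)} (hκ : IsCenteredChart a κ) :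
    ∃! ψ, IsPsiMap X w a κ ψ := by
  obtain ⟨L, hL⟩ := exists_linearlyAdapted (hX.linearIndependent a haU) hκ
  have hθ := hκ.transDiffeomorph L.toDiffeomorph (map_zero L)
  have hLκ : LinearlyAdapted X a (fun p => L (κ p)) := (hL L.toLinearEquiv.toAffineEquiv).2 rfl
  obtain ⟨f, ⟨hf, hfY⟩, f_unique⟩ :=
    (hθ.isAdaptedFrame_pushFrame hX hU haU hLκ).existsUnique_triangular hX.one_le_weight
  have privileged_iff {g : Euc n → Euc n} (hg : IsTriangularPoly w g) :=
    (hX.privileged_iff hU haU hθ hLκ hg.contDiff.contDiffAt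
      (h := fun p => g (L (κ p))) Filter.EventuallyEq.rfl).trans (and_iff_right hg.hasFDerivAt_zero)
  refine ⟨fun x => f (L x), ⟨L.toLinearEquiv.toAffineEquiv, f, hLκ, hf,
    (privileged_iff hf).2 hfY, rfl⟩, ?_⟩
  rintro _ ⟨T, g, hT, hg, hgp, rfl⟩
  simp only [(hL T).1 hT] at hgp ⊢
  rw [f_unique g ⟨hg, (privileged_iff hg).1 hgp⟩]

theorem IsWeightedFrameOn.isPsiMap_psiMap (hX : IsWeightedFrameOn w X U) (hU : IsOpen U)
    (haU : a ∈ U) {κ : OpenPartialHomeomorph M (Euc n)} (hκ : IsCenteredChart a κ) :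
    IsPsiMap X w a κ (psiMap X w a κ) :=
  Classical.epsilon_spec (hX.existsUnique_isPsiMap hU haU hκ).exists

theorem IsPsiMap.exists_isCenteredChart (hX : LinearIndependent ℝ fun j => X j a)
    {κ : OpenPartialHomeomorph M (Euc n)} (hκ : IsCenteredChart a κ) {ψ : Euc n → Euc n}
    (hψ : IsPsiMap X w a κ ψ) :
    ∃ θ : OpenPartialHomeomorph M (Euc n), IsCenteredChart a θ ∧ Privileged X w a θ ∧
      ∀ p, θ p = ψ (κ p) := by
  obtain ⟨T, f, hT, hf, hp, rfl⟩ := hψ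
  obtain ⟨L, hL⟩ := exists_linearlyAdapted hX hκ
  simp only [(hL T).1 hT] at hp ⊢
  obtain ⟨Φ, rfl⟩ := hf.exists_diffeomorph
  exact ⟨_, (hκ.transDiffeomorph L.toDiffeomorph (map_zero L)).transDiffeomorph Φ hf.map_zero, hp,
    fun _ => rfl⟩

theorem IsWeightedFrameOn.privileged_iff_exists_isAdmissibleChange (hX : IsWeightedFrameOn w X U)
    (hU : IsOpen U) (haU : a ∈ U) {N : Euc n → ℝ} (hN : IsPseudoNorm w N)
    {θ χ : OpenPartialHomeomorph M (Euc n)} (hθ : IsCenteredChart a θ) (hθp : Privileged X w a θ)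
    (hχ : χ ∈ IsManifold.maximalAtlas (𝓡 n) ∞ M) (haχ : a ∈ χ.source) :
    Privileged X w a χ ↔ ∃ φ : OpenPartialHomeomorph (Euc n) (Euc n),
      IsAdmissibleChange w N φ ∧ ∀ᶠ p in 𝓝 a, χ p = φ (θ p) := by
  have hY := hθ.isAdaptedFrame_pushFrame hX hU haU hθp.1
  have hx := ((hX.privileged_iff hU haU hθ hθp.1 contDiffAt_id
    (Filter.EventuallyEq.rfl (f := θ))).1 hθp).2
  have admissible_iff {φ : OpenPartialHomeomorph (Euc n) (Euc n)} (h0 : 0 ∈ φ.source)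
      (hφ : ContDiffOn ℝ ∞ φ φ.source) (hφsymm : ContDiffOn ℝ ∞ φ.symm φ.target)
      (hχφ : χ =ᶠ[𝓝 a] φ ∘ θ) : Privileged X w a χ ↔ IsAdmissibleChange w N φ :=
    (hX.privileged_iff hU haU hθ hθp.1 (hφ.contDiffAt (φ.open_source.mem_nhds h0)) hχφ).trans
      (hY.isAdmissibleChange_iff hX.one_le_weight hN hx h0 hφ hφsymm).symm
  refine ⟨fun h => ?_, fun ⟨φ, hφ, hχφ⟩ =>
    (admissible_iff hφ.zero_mem hφ.contDiffOn hφ.contDiffOn_symm hχφ).2 hφ⟩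
  have transition : χ =ᶠ[𝓝 a] θ.symm.trans χ ∘ θ := by
    filter_upwards [θ.open_source.mem_nhds hθ.mem_source] with p hp
    exact congrArg χ (θ.left_inv hp).symm
  have zero_mem : (0 : Euc n) ∈ (θ.symm.trans χ).source :=
    ⟨hθ.zero_mem_target, by
      change θ.symm 0 ∈ χ.source
      rwa [hθ.symm_zero]⟩
  exact ⟨θ.symm.trans χ, (admissible_iff zero_mem
    (contMDiffOn_of_mem_contDiffGroupoid
      (IsManifold.compatible_of_mem_maximalAtlas hθ.mem_maximalAtlas hχ)).contDiffOn
    (contMDiffOn_of_mem_contDiffGroupoid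
      (IsManifold.compatible_of_mem_maximalAtlas hχ hθ.mem_maximalAtlas)).contDiffOn
    transition).1 h, transition⟩

theorem IsWeightedFrameOn.privileged_iff_eventually_eq_psiMap (hX : IsWeightedFrameOn w X U)
    (hU : IsOpen U) (haU : a ∈ U) {N : Euc n → ℝ} (hN : IsPseudoNorm w N)
    {κ χ : OpenPartialHomeomorph M (Euc n)} (hκ : IsCenteredChart a κ)
    (hχ : χ ∈ IsManifold.maximalAtlas (𝓡 n) ∞ M) (haχ : a ∈ χ.source) :
    Privileged X w a χ ↔ ∃ φ : OpenPartialHomeomorph (Euc n) (Euc n),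
      IsAdmissibleChange w N φ ∧ ∀ᶠ p in 𝓝 a, χ p = φ (psiMap X w a κ (κ p)) := by
  obtain ⟨θ, hθ, hθp, hθψ⟩ := (hX.isPsiMap_psiMap hU haU hκ).exists_isCenteredChart
    (hX.linearIndependent a haU) hκ
  simp only [← hθψ]
  exact hX.privileged_iff_exists_isAdmissibleChange hU haU hN hθ hθp hχ haχ

theorem isTriangularPoly_id (w : Fin n → ℕ) : IsTriangularPoly w (id : Euc n → Euc n) :=
  ⟨fun _ => 0, by simp, by simp⟩

theorem IsWeightedFrameOn.psiMap_eq_id (hX : IsWeightedFrameOn w X U) (hU : IsOpen U)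
    (haU : a ∈ U) {χ : OpenPartialHomeomorph M (Euc n)} (hχ : IsCenteredChart a χ)
    (hχp : Privileged X w a χ) : psiMap X w a χ = id :=
  (hX.existsUnique_isPsiMap hU haU hχ).unique (hX.isPsiMap_psiMap hU haU hχ)
    ⟨AffineEquiv.refl ℝ _, id, hχp.1, isTriangularPoly_id _, hχp, rfl⟩

theorem isAdmissibleChange_refl (w : Fin n → ℕ) (N : Euc n → ℝ) :
    IsAdmissibleChange w N (OpenPartialHomeomorph.refl (Euc n)) where
  zero_mem := Set.mem_univ _
  contDiffOn := contDiffOn_id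
  contDiffOn_symm := contDiffOn_id
  hasFDerivAt := hasFDerivAt_id _
  expansion := ⟨Diffeomorph.refl _ _ _, ⟨fun k => MvPolynomial.X k, by simp⟩, fun _ _ => rfl,
    hasFDerivAt_id _, fun k => by simpa using Asymptotics.isBigO_zero _ _⟩

end PrivilegedCoordinates

end CarnotMfd

theorem corollary5p6_general {n : ℕ} {M : Type*} [TopologicalSpace M]
    [ChartedSpace (CarnotMfd.Euc n) M] [IsManifold (𝓡 n) ∞ M] (a : M)
    (U : Set M) (hU : IsOpen U) (haU : a ∈ U)
    (w : Fin n → ℕ) (X : Fin n → CarnotMfd.VField n M) (hX : CarnotMfd.IsWeightedFrameOn w X U)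
    (N : CarnotMfd.Euc n → ℝ) (hN : CarnotMfd.IsPseudoNorm w N) :
    (∀ κ : OpenPartialHomeomorph M (CarnotMfd.Euc n), CarnotMfd.IsCenteredChart a κ →
      CarnotMfd.IsPsiMap X w a κ (CarnotMfd.psiMap X w a κ) ∧
        ∀ ψ, CarnotMfd.IsPsiMap X w a κ ψ → ψ = CarnotMfd.psiMap X w a κ) ∧
    ∀ χ : OpenPartialHomeomorph M (CarnotMfd.Euc n),
      χ ∈ IsManifold.maximalAtlas (𝓡 n) ∞ M → a ∈ χ.source →
      (CarnotMfd.Privileged X w a χ ↔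
        ∃ (κ : OpenPartialHomeomorph M (CarnotMfd.Euc n))
          (φ : OpenPartialHomeomorph (CarnotMfd.Euc n) (CarnotMfd.Euc n)),
          CarnotMfd.IsCenteredChart a κ ∧ CarnotMfd.IsAdmissibleChange w N φ ∧
          χ.source = {p ∈ κ.source | CarnotMfd.psiMap X w a κ (κ p) ∈ φ.source} ∧
          ∀ p ∈ χ.source, χ p = φ (CarnotMfd.psiMap X w a κ (κ p))) ∧
      ∀ κ : OpenPartialHomeomorph M (CarnotMfd.Euc n), CarnotMfd.IsCenteredChart a κ →
        (CarnotMfd.Privileged X w a χ ↔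
          ∃ φ : OpenPartialHomeomorph (CarnotMfd.Euc n) (CarnotMfd.Euc n),
            CarnotMfd.IsAdmissibleChange w N φ ∧
            ∀ᶠ p in 𝓝 a, χ p = φ (CarnotMfd.psiMap X w a κ (κ p))) := by
  refine ⟨fun κ hκ => ⟨hX.isPsiMap_psiMap hU haU hκ, fun ψ hψ =>
    (hX.existsUnique_isPsiMap hU haU hκ).unique hψ (hX.isPsiMap_psiMap hU haU hκ)⟩,
    fun χ hχ haχ => ⟨⟨fun hp => ?_, ?_⟩, fun κ hκ =>
      hX.privileged_iff_eventually_eq_psiMap hU haU hN hκ hχ haχ⟩⟩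
  · have hχc : CarnotMfd.IsCenteredChart a χ := ⟨hχ, haχ, hp.1.1⟩
    have psiMap_eq_id := hX.psiMap_eq_id hU haU hχc hp
    exact ⟨χ, OpenPartialHomeomorph.refl _, hχc, CarnotMfd.isAdmissibleChange_refl w N,
      by simp, by simp [psiMap_eq_id]⟩
  · rintro ⟨κ, φ, hκ, hφ, -, heq⟩
    exact (hX.privileged_iff_eventually_eq_psiMap hU haU hN hκ hχ haχ).2
      ⟨φ, hφ, Filter.eventually_of_mem (χ.open_source.mem_nhds haχ) heq⟩

theorem corollary5p6 {n r : ℕ} {M : Type*} [TopologicalSpace M]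
    [ChartedSpace (CarnotMfd.Euc n) M] [IsManifold (𝓡 n) ∞ M]
    (H : CarnotMfd.CarnotFiltration n r M) (a : M)
    (U : Set M) (hU : IsOpen U) (haU : a ∈ U)
    (X : Fin n → CarnotMfd.VField n M) (hX : CarnotMfd.IsHFrameOn H X U)
    (N : CarnotMfd.Euc n → ℝ) (hN : CarnotMfd.IsPseudoNorm H.weight N) :
    -- the map `ψ_{κ(a)}` exists and is unique
    (∀ κ : OpenPartialHomeomorph M (CarnotMfd.Euc n), CarnotMfd.IsCenteredChart a κ →
      CarnotMfd.IsPsiMap X H.weight a κ (CarnotMfd.psiMap X H.weight a κ) ∧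
        ∀ ψ, CarnotMfd.IsPsiMap X H.weight a κ ψ → ψ = CarnotMfd.psiMap X H.weight a κ) ∧
    ∀ χ : OpenPartialHomeomorph M (CarnotMfd.Euc n),
      χ ∈ IsManifold.maximalAtlas (𝓡 n) ∞ M → a ∈ χ.source →
      -- `χ` is privileged iff it is of the form `φ ∘ ψ_{κ(a)} ∘ κ` on its whole domain
      (CarnotMfd.Privileged X H.weight a χ ↔
        ∃ (κ : OpenPartialHomeomorph M (CarnotMfd.Euc n))
          (φ : OpenPartialHomeomorph (CarnotMfd.Euc n) (CarnotMfd.Euc n)),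
          CarnotMfd.IsCenteredChart a κ ∧ CarnotMfd.IsAdmissibleChange H.weight N φ ∧
          χ.source = {p ∈ κ.source | CarnotMfd.psiMap X H.weight a κ (κ p) ∈ φ.source} ∧
          ∀ p ∈ χ.source, χ p = φ (CarnotMfd.psiMap X H.weight a κ (κ p))) ∧
      -- and, for any `κ` given in advance, iff it is of that form near `a`
      ∀ κ : OpenPartialHomeomorph M (CarnotMfd.Euc n), CarnotMfd.IsCenteredChart a κ →
        (CarnotMfd.Privileged X H.weight a χ ↔
          ∃ φ : OpenPartialHomeomorph (CarnotMfd.Euc n) (CarnotMfd.Euc n),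
            CarnotMfd.IsAdmissibleChange H.weight N φ ∧
            ∀ᶠ p in 𝓝 a, χ p = φ (CarnotMfd.psiMap X H.weight a κ (κ p))) :=
  corollary5p6_general a U hU haU H.weight X (hX.isWeightedFrameOn hU a) N hN
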